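/- **Setting.** Let $b,\sigma:\mathbb R\to\mathbb R$ satisfy the weak confinement assumption: $b,\sigma$ are smooth, $-b(x)x/|x|\to\infty$ as $|x|\to\infty$, $\sigma$ is bounded, and $\sigma^2\ge S_1$ for some constant $S_1>0$. Put $s:=b-\sigma\sigma'$ and suppose that $s$ is confining as well, i.e. $-s(x)x/|x|\to\infty$ as $|x|\to\infty$ (this is automatic when $\sigma'$ is bounded). Fix $h>0$, let $x_j=jh$ for $j\in\mathbb Z$, $s_j^+=\max(s(x_j),0)$, $s_j^-=-\min(s(x_j),0)$, $\sigma^2_{j\pm1/2}=\sigma(x_j\pm\tfrac h2)^2$, and $$\alpha_j=\frac{s_j^+}{h}+\frac{\sigma_{j+1/2}^2}{2h^2},\qquad \beta_j=\frac{s_j^-}{h}+\frac{\sigma_{j-1/2}^2}{2h^2}.$$ Let $Z(t)$ be the continuous-time Markov chain on $\mathbb Z$ that jumps from $j$ to $j+1$ at rate $\alpha_j$ and from $j$ to $j-1$ at rate $\beta_j$, with transition probabilities $p_t(i,j)=\mathbb P(Z(t)=j\mid Z(0)=i)$; that is, $p_t$ is a stochastic transition function on $\mathbb Z$ with $p_0(i,j)=\delta_{ij}$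 whose derivative at $t=0$ is the $Q$-matrix with $Q(j,j+1)=\alpha_j$, $Q(j,j-1)=\beta_j$, $Q(j,j)=-(\alpha_j+\beta_j)$, and $0$ otherwise. A stationary distribution is a probability distribution $\pi^h$ on $\mathbb Z$ with $\alpha_{j-1}\pi^h_{j-1}+\beta_{j+1}\pi^h_{j+1}-(\alpha_j+\beta_j)\pi^h_j=0$ for all $j$. Let $\|u\|_{\ell^1}=\sum_j h|u_j|$. A solution of the upwind scheme is a family $\rho^h(t)=(\rho_j(t))_{j\in\mathbb Z}$, $t\ge0$, that is nonnegative, summable, has conserved mass $\sum_j h\rho_j(t)=\sum_j h\rho_j(0)$, and satisfies for all $j$ and $t\ge0$ $$\frac{d}{dt}\rho_j=-\Big(\frac{s_j^+\rho_j-s_{j-1}^+\rho_{j-1}}{h}-\frac{s_{j+1}^-\rho_{j+1}-s_j^-\rho_j}{h}\Big)+\frac1{2h^2}\Big(\sigma_{j+1/2}^2\rho_{j+1}-(\sigma_{j+1/2}^2+\sigma_{j-1/2}^2)\rho_j+\sigma_{j-1/2}^2\rho_{j-1}\Big)$$ (one-sided derivative at $t=0$). **Proposition 4.2.** There are exactly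 one stationary distribution $\pi^h$, exactly one transition function $p_t(i,j)$, $t\ge 0$, as above, and, for every nonnegative summable initial sequence, exactly one solution of the upwind scheme. Moreover: 1. $p_t(i,j)\to\pi^h_j$ as $t\to\infty$ for all $i,j\in\mathbb Z$. 2. Let $\rho^h$ be a solution of the upwind scheme with $\|\rho^h(0)\|_{\ell^1}>0$ and put $p_j(t)=h\rho_j(t)/\|\rho^h(0)\|_{\ell^1}$. Then $p_j(t)=\sum_i p_i(0)\,p_t(i,j)$ for all $j$ and $t\ge0$. If there is a constant $C$ with $p_j(0)\le C\pi^h_j$ for all $j$, then $$\sum_{j\in\mathbb Z}|p_j(t)-\pi_j^h|\to0,\qquad t\to\infty.$$ 3. Consequently, under the same condition, $\big\|\rho^h(t)-\tfrac1h\pi^h\|\rho^h(0)\|_{\ell^1}\big\|_{\ell^1}\to0$ as $t\to\infty$; and for every $\rho^0\in L^1(\mathbb R)$, $$\big\|\rho^h(t)-\tfrac1h\pi^h\|\rho^0\|_{L^1(\mathbb R)}\big\|_{\ell^1}\to\big|\,\|\rho^h(0)\|_{\ell^1}-\|\rho^0\|_{L^1(\mathbb R)}\big|,\qquad t\to\infty.$$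 -/

import Mathlib

open Filter Topology MeasureTheory
open scoped ContDiff

/-- Weak confinement in dimension one: `b` and `σ` are smooth,
`-b(x) x / |x| → ∞` as `|x| → ∞`, `σ` is bounded and `σ² ≥ S₁ > 0`. -/
structure WeakConfinement (b σ : ℝ → ℝ) : Prop where
  smooth_drift : ContDiff ℝ ∞ b
  smooth_diffusion : ContDiff ℝ ∞ σ
  confining : Tendsto (fun x : ℝ => -(b x * x) / |x|) (cocompact ℝ) atTop
  bounded : ∃ S₂ : ℝ, ∀ x, |σ x| ≤ S₂
  elliptic : ∃ S₁ : ℝ, 0 < S₁ ∧ ∀ x, S₁ ≤ σ x ^ 2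

/-- The advection speed `s = b - σ σ'` of the conservative form
`∂ₜρ = -∂ₓ((b - σσ')ρ) + ½ ∂ₓ(σ² ∂ₓρ)` of the Fokker-Planck equation. -/
noncomputable def advSpeed (b σ : ℝ → ℝ) (x : ℝ) : ℝ := b x - σ x * deriv σ x

/-- `s⁺` at the grid point `x_j = j h`. -/
noncomputable def sPlus (b σ : ℝ → ℝ) (h : ℝ) (j : ℤ) : ℝ := max (advSpeed b σ (j * h)) 0

/-- `s⁻` at the grid point `x_j = j h`, so that `s = s⁺ - s⁻` and `s⁻ ≥ 0`. -/
noncomputable def sMinus (b σ : ℝ → ℝ) (h : ℝ) (j : ℤ) : ℝ := -min (advSpeed b σ (j * h)) 0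

/-- `σ²_{j+1/2} = σ(x_j + h/2)²`. -/
noncomputable def sigmaSqHalf (σ : ℝ → ℝ) (h : ℝ) (j : ℤ) : ℝ := σ (j * h + h / 2) ^ 2

/-- The right-hand side of the semi-discrete upwind scheme at site `j`. -/
noncomputable def upwindRHS (b σ : ℝ → ℝ) (h : ℝ) (ρ : ℤ → ℝ) (j : ℤ) : ℝ :=
  -((sPlus b σ h j * ρ j - sPlus b σ h (j - 1) * ρ (j - 1)) / h
      - (sMinus b σ h (j + 1) * ρ (j + 1) - sMinus b σ h j * ρ j) / h)
    + 1 / (2 * h ^ 2) *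
      (sigmaSqHalf σ h j * ρ (j + 1) - (sigmaSqHalf σ h j + sigmaSqHalf σ h (j - 1)) * ρ j
        + sigmaSqHalf σ h (j - 1) * ρ (j - 1))

/-- The rate `α_j` of jumping from site `j` to site `j + 1`. -/
noncomputable def rateRight (b σ : ℝ → ℝ) (h : ℝ) (j : ℤ) : ℝ :=
  sPlus b σ h j / h + 1 / (2 * h ^ 2) * sigmaSqHalf σ h j

/-- The rate `β_j` of jumping from site `j` to site `j - 1`. -/
noncomputable def rateLeft (b σ : ℝ → ℝ) (h : ℝ) (j : ℤ) : ℝ :=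
  sMinus b σ h j / h + 1 / (2 * h ^ 2) * sigmaSqHalf σ h (j - 1)

/-- The operator `ℒ_h^*` of the forward equation (discrete Fokker-Planck equation). -/
noncomputable def forwardOp (b σ : ℝ → ℝ) (h : ℝ) (p : ℤ → ℝ) (j : ℤ) : ℝ :=
  rateRight b σ h (j - 1) * p (j - 1) + rateLeft b σ h (j + 1) * p (j + 1)
    - (rateRight b σ h j + rateLeft b σ h j) * p j

/-- The `Q`-matrix of the jump process `Z`. -/
noncomputable def jumpQ (b σ : ℝ → ℝ) (h : ℝ) (i j : ℤ) : ℝ :=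
  if j = i then -(rateRight b σ h i + rateLeft b σ h i)
  else if j = i + 1 then rateRight b σ h i
  else if j = i - 1 then rateLeft b σ h i
  else 0

/-- `P t i j = ℙ(Z(t) = j | Z(0) = i)`, `t ≥ 0`, is the transition function of a continuous-time
Markov chain `Z` on `ℤ` with jump rates `α, β`: a (stochastic) Markov transition function whose
derivative at time `0` is the `Q`-matrix. Continuity at time `0` follows from
`hasDeriv_zero`. Values at negative times are irrelevant. -/
structure IsJumpTransitionFunction (b σ : ℝ → ℝ) (h : ℝ) (P : ℝ → ℤ → ℤ → ℝ) : Prop where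
  nonneg : ∀ t, 0 ≤ t → ∀ i j, 0 ≤ P t i j
  total : ∀ t, 0 ≤ t → ∀ i, HasSum (fun j => P t i j) 1
  zero : ∀ i j, P 0 i j = if i = j then 1 else 0
  chapman_kolmogorov : ∀ s t, 0 ≤ s → 0 ≤ t → ∀ i j,
    HasSum (fun k => P s i k * P t k j) (P (s + t) i j)
  hasDeriv_zero : ∀ i j, HasDerivWithinAt (fun t => P t i j) (jumpQ b σ h i j) (Set.Ici 0) 0

/-- A probability distribution on `ℤ` that is a stationary solution of the forward equation. -/
structure IsStationaryDistribution (b σ : ℝ → ℝ) (h : ℝ) (π : ℤ → ℝ) : Prop where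
  nonneg : ∀ j, 0 ≤ π j
  total : HasSum π 1
  stationary : ∀ j, forwardOp b σ h π j = 0

/-- The norm `‖u‖_{ℓ¹} = ∑_j h |u_j|`. -/
noncomputable def gridL1Norm (h : ℝ) (u : ℤ → ℝ) : ℝ := ∑' j, h * |u j|

/-- `ρ t j = ρ_j(t)`, `t ≥ 0`, is a solution of the upwind scheme: nonnegative, summable,
with conserved mass. (Without conservation of mass the infinite system of
equations alone does not determine the solution: mass may enter from infinity.) -/
structure IsUpwindSolution (b σ : ℝ → ℝ) (h : ℝ) (ρ : ℝ → ℤ → ℝ) : Prop where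
  nonneg : ∀ t, 0 ≤ t → ∀ j, 0 ≤ ρ t j
  summable : ∀ t, 0 ≤ t → Summable (ρ t)
  mass : ∀ t, 0 ≤ t → ∑' j, h * ρ t j = ∑' j, h * ρ 0 j
  scheme : ∀ t, 0 ≤ t → ∀ j,
    HasDerivWithinAt (fun r => ρ r j) (upwindRHS b σ h (ρ t) j) (Set.Ici 0) t

/-- The normalized solution `p_j(t) = h ρ_j(t) / ‖ρ(0)‖_{ℓ¹}`. -/
noncomputable def normalizedSol (h : ℝ) (ρ : ℝ → ℤ → ℝ) (t : ℝ) (j : ℤ) : ℝ :=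
  h * ρ t j / gridL1Norm h (ρ 0)

/-! The scheme is the forward equation of a birth-death process with rates `rateRight` and
`rateLeft`. Confinement of `s`, boundedness of `σ` and ellipticity are used only through
`ConfiningRates`: all rates are positive, jumps away from the origin have bounded rates, jumps
towards it have rates tending to infinity.

Well-posedness. For `i ≠ 0` the generator maps `|i|` to outward rate minus inward rate, so `ℒ|i| ≤
K`. Hence `c (|i| + K t)` is a supersolution that, however small `c > 0`, exceeds any bounded
function far out. This gives a maximum principle for bounded backward solutions on all of `ℤ`
(`IsBackwardSol.barrier_le`), and with it uniqueness, conservation of probability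
(`hasSum_transition`), and convergence of the solutions killed outside `[-N, N]` with error `B (|i|
+ K t) / (N + 1)`. Every transition function with the given `Q`-matrix solves the backward equation,
hence is the one so constructed. The forward equation follows because killing commutes with the
generator on point masses. Pairing a forward solution with the killed process shows that it
dominates the law with the same initial value (`IsForwardSol.sum_killedSol_le`); equal total mass
forces equality.

Equilibrium. A stationary sequence has constant flux, and summability with bounded outward rates
makes the flux zero. Detailed balance fixes the sequence up to a factor, and its product solution is
summable by the ratio test.

Convergence. By reversibility the energy `∑ π u²` decreases at the rate `2 ∑ a_k π_k (u_{k+1} -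
u_k)²`. Each difference is Lipschitz in time, so it tends to zero (`tendsto_semigroup_sub`).
Averaging `p_t(i,j) - p_t(k,j)` over `k` with the invariant weights `π_k` gives `p_t(i,j) → π_j`. An
initial bound by `C π` is preserved in time, and dominated convergence upgrades pointwise to `ℓ¹`
convergence. -/

/-- Termwise differentiation on `[0, ∞)`: pointwise convergence together with locally uniform
convergence of the derivatives. -/
theorem hasDerivWithinAt_Ici_of_tendstoUniformlyOn {ι : Type*} {l : Filter ι} [NeBot l]
    {F F' : ι → ℝ → ℝ} {G G' : ℝ → ℝ}
    (hF : ∀ n t, 0 ≤ t → HasDerivWithinAt (F n) (F' n t) (Set.Ici 0) t)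
    (hlim : ∀ t, 0 ≤ t → Tendsto (fun n => F n t) l (𝓝 (G t)))
    (hunif : ∀ T, 0 < T → TendstoUniformlyOn F' G' l (Set.Ico 0 T)) :
    ∀ t, 0 ≤ t → HasDerivWithinAt G (G' t) (Set.Ici 0) t := by
  intro t ht
  -- Continuing each function linearly to negative times makes it differentiable on the whole line,
  -- so that the theorem on open sets covers the endpoint `0`.
  have hder : ∀ n x, HasDerivAt (fun t => if 0 ≤ t then F n t else F n 0 + t * F' n 0)
      (F' n (max x 0)) x := by
    intro n x
    have hlin : ∀ y : ℝ, HasDerivAt (fun t => F n 0 + t * F' n 0) (F' n 0) y := fun y => by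
      simpa using ((hasDerivAt_id y).mul_const (F' n 0)).const_add (F n 0)
    rcases lt_trichotomy x 0 with hx | rfl | hx
    · rw [max_eq_right hx.le]
      refine (hlin x).congr_of_eventuallyEq ?_
      filter_upwards [Iio_mem_nhds hx] with y hy
      rw [if_neg (not_le.2 hy)]
    · rw [max_self, ← hasDerivWithinAt_univ, ← Set.Iic_union_Ici (a := (0 : ℝ))]
      refine HasDerivWithinAt.union ?_ ?_
      · refine (hlin 0).hasDerivWithinAt.congr (fun y hy => ?_) (by simp)
        rcases (Set.mem_Iic.1 hy).lt_or_eq with h | rfl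
        · rw [if_neg (not_le.2 h)]
        · simp
      · exact (hF n 0 le_rfl).congr (fun y hy => if_pos hy) (by simp)
    · rw [max_eq_left hx.le]
      refine ((hF n x hx.le).hasDerivAt (Ici_mem_nhds hx)).congr_of_eventuallyEq ?_
      filter_upwards [Ioi_mem_nhds hx] with y hy
      rw [if_pos (le_of_lt hy)]
  have key : HasDerivAt (fun t => if 0 ≤ t then G t else G 0 + t * G' 0) (G' (max t 0)) t := by
    refine hasDerivAt_of_tendstoUniformlyOn (l := l) (s := Set.Iio (t + 1)) isOpen_Iio
      (f := fun n t => if 0 ≤ t then F n t else F n 0 + t * F' n 0)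
      (f' := fun n x => F' n (max x 0)) (g' := fun x => G' (max x 0)) ?_
      (Eventually.of_forall fun n x _ => hder n x) ?_ (by simp)
    · intro u hu
      filter_upwards [hunif (t + 1) (by linarith) u hu] with n hn x hx
      exact hn _ ⟨le_max_right _ _, max_lt hx (by linarith)⟩
    · intro x _
      by_cases hx : 0 ≤ x
      · simpa [hx] using hlim x hx
      · simp only [hx, if_false]
        refine (hlim 0 le_rfl).add (Tendsto.const_mul _ ?_)
        exact (hunif 1 one_pos).tendsto_at ⟨le_rfl, one_pos⟩
  rw [max_eq_left ht] at key
  exact key.hasDerivWithinAt.congr (fun y hy => (if_pos hy).symm) (if_pos ht).symm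

/-! ### Birth-death generators and the Lyapunov function `|i|` -/

/-- The generator `(ℒu)_i = a_i (u_{i+1} - u_i) + b_i (u_{i-1} - u_i)` of a birth-death process. -/
def birthDeathGen (a b : ℤ → ℝ) (u : ℤ → ℝ) (i : ℤ) : ℝ :=
  a i * (u (i + 1) - u i) + b i * (u (i - 1) - u i)

/-- The adjoint of `birthDeathGen`. -/
def birthDeathFwd (a b : ℤ → ℝ) (p : ℤ → ℝ) (j : ℤ) : ℝ :=
  a (j - 1) * p (j - 1) + b (j + 1) * p (j + 1) - (a j + b j) * p j

/-- Positive jump rates on `ℤ` for which the outward rates are bounded and the inward rates tend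
to infinity. -/
structure ConfiningRates (a b : ℤ → ℝ) : Prop where
  right_pos : ∀ j, 0 < a j
  left_pos : ∀ j, 0 < b j
  bounded : ∃ A, (∀ j, 0 ≤ j → a j ≤ A) ∧ ∀ j, j ≤ 0 → b j ≤ A
  left_tendsto : Tendsto b atTop atTop
  right_tendsto : Tendsto a atBot atTop

/-- Solutions of the backward equation `u' = ℒu`, with right derivatives. -/
structure IsBackwardSol (a b : ℤ → ℝ) (u : ℝ → ℤ → ℝ) : Prop where
  continuousOn : ∀ i, ContinuousOn (fun t => u t i) (Set.Ici 0)
  hasDeriv : ∀ t, 0 ≤ t → ∀ i,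
    HasDerivWithinAt (fun r => u r i) (birthDeathGen a b (u t) i) (Set.Ici t) t

section
variable {a b : ℤ → ℝ}

theorem birthDeathGen_add (u v : ℤ → ℝ) (i : ℤ) :
    birthDeathGen a b (fun k => u k + v k) i = birthDeathGen a b u i + birthDeathGen a b v i := by
  simp only [birthDeathGen]; ring

theorem birthDeathGen_sub (u v : ℤ → ℝ) (i : ℤ) :
    birthDeathGen a b (fun k => u k - v k) i = birthDeathGen a b u i - birthDeathGen a b v i := by
  simp only [birthDeathGen]; ring

theorem birthDeathGen_const_mul (c : ℝ) (u : ℤ → ℝ) (i : ℤ) :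
    birthDeathGen a b (fun k => c * u k) i = c * birthDeathGen a b u i := by
  simp only [birthDeathGen]; ring

theorem birthDeathGen_neg (u : ℤ → ℝ) (i : ℤ) :
    birthDeathGen a b (fun k => -u k) i = -birthDeathGen a b u i := by
  simp only [birthDeathGen]; ring

theorem birthDeathGen_const (c : ℝ) (i : ℤ) : birthDeathGen a b (fun _ => c) i = 0 := by
  simp [birthDeathGen]

/-- For `i ≠ 0` only outward minus inward rate remains, at most `A`; at the origin both jumps lead
outwards, whence `2 * A`. This Lyapunov bound is what excludes explosion. -/
theorem exists_birthDeathGen_abs_le (hab : ConfiningRates a b) :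
    ∃ K, 0 ≤ K ∧ ∀ i, birthDeathGen a b (fun k => |(k : ℝ)|) i ≤ K := by
  obtain ⟨A, hA, hB⟩ := hab.bounded
  have h0 := hab.right_pos 0
  have h1 := hab.left_pos 0
  have h2 := hA 0 le_rfl
  have h3 := hB 0 le_rfl
  refine ⟨2 * A, by linarith, fun i => ?_⟩
  have ha := hab.right_pos i
  have hb := hab.left_pos i
  simp only [birthDeathGen]
  rcases lt_trichotomy i 0 with hi | rfl | hi
  · have hi' : (i : ℝ) + 1 ≤ 0 := by exact_mod_cast hi
    have := hB i hi.le
    push_cast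
    rw [abs_of_nonpos hi', abs_of_neg (by linarith : (i : ℝ) < 0),
      abs_of_neg (by linarith : (i : ℝ) - 1 < 0)]
    linarith
  · simp
    linarith
  · have hi' : (1 : ℝ) ≤ i := by exact_mod_cast hi
    have := hA i hi.le
    push_cast
    rw [abs_of_pos (by linarith : (0 : ℝ) < i + 1), abs_of_pos (by linarith : (0 : ℝ) < i),
      abs_of_nonneg (by linarith : (0 : ℝ) ≤ i - 1)]
    linarith

/-! ### Finite systems: maximum principle and solvability -/

/-- Maximum principle on a finite set of sites. -/
theorem nonneg_of_birthDeathGen_le (ha : ∀ i, 0 ≤ a i) (hb : ∀ i, 0 ≤ b i) (F : Finset ℤ)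
    {w d : ℝ → ℤ → ℝ} {T : ℝ}
    (hcont : ∀ i ∈ F, ContinuousOn (fun t => w t i) (Set.Icc 0 T))
    (hder : ∀ i ∈ F, ∀ t, 0 ≤ t → t < T →
      HasDerivWithinAt (fun r => w r i) (d t i) (Set.Ici t) t)
    (hd : ∀ i ∈ F, ∀ t, 0 ≤ t → t < T → birthDeathGen a b (w t) i ≤ d t i)
    (h0 : ∀ i ∈ F, 0 ≤ w 0 i) (hout : ∀ i ∉ F, ∀ t, 0 ≤ t → t ≤ T → 0 ≤ w t i) :
    ∀ t, 0 ≤ t → t ≤ T → ∀ i, 0 ≤ w t i := by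
  -- The perturbation `ε * (1 + t)` makes the inequality strict at a first contact with zero; `ε` is
  -- removed at the end.
  have main : ∀ ε, 0 < ε → ∀ t ∈ Set.Icc 0 T, ∀ i ∈ F, 0 ≤ w t i + ε * (1 + t) := by
    intro ε hε
    have hc : ∀ i ∈ F, ContinuousOn (fun t => w t i + ε * (1 + t)) (Set.Icc 0 T) := fun i hi =>
      (hcont i hi).add (by fun_prop)
    have hclosed : IsClosed ({t | ∀ i ∈ F, 0 ≤ w t i + ε * (1 + t)} ∩ Set.Icc 0 T) := by
      have : {t | ∀ i ∈ F, 0 ≤ w t i + ε * (1 + t)} ∩ Set.Icc 0 T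
          = Set.Icc 0 T ∩ ⋂ i ∈ F, Set.Icc 0 T ∩ {t | 0 ≤ w t i + ε * (1 + t)} := by
        ext t
        simp only [Set.mem_inter_iff, Set.mem_ofPred_eq, Set.mem_iInter]
        exact ⟨fun h => ⟨h.2, fun i hi => ⟨h.2, h.1 i hi⟩⟩, fun h => ⟨fun i hi => (h.2 i hi).2, h.1⟩⟩
      rw [this]
      refine isClosed_Icc.inter (isClosed_biInter fun i hi => ?_)
      exact (hc i hi).preimage_isClosed_of_isClosed isClosed_Icc isClosed_Ici
    refine hclosed.Icc_subset_of_forall_mem_nhdsWithin ?_ ?_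
    · intro i hi
      have := h0 i hi
      simp; linarith
    · rintro t ⟨htS, ht0, htT⟩
      simp only [Set.mem_ofPred_eq] at htS
      have : ∀ i ∈ F, ∀ᶠ s in 𝓝[>] t, 0 ≤ w s i + ε * (1 + s) := by
        intro i hi
        have hD : HasDerivWithinAt (fun s => w s i + ε * (1 + s)) (d t i + ε) (Set.Ici t) t := by
          have := ((hasDerivWithinAt_id t (Set.Ici t)).const_add 1).const_mul ε
          simpa using (hder i hi t ht0 htT).fun_add this
        rcases (htS i hi).lt_or_eq with hpos | hzero
        · have := hD.continuousWithinAt.eventually (lt_mem_nhds hpos)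
          exact (this.filter_mono (nhdsWithin_mono _ Set.Ioi_subset_Ici_self)).mono fun s hs => hs.le
        · have hall : ∀ k, 0 ≤ w t k + ε * (1 + t) := by
            intro k
            by_cases hk : k ∈ F
            · exact htS k hk
            · have := hout k hk t ht0 htT.le
              positivity
          -- At a contact site the perturbed function has its spatial minimum, so the generator is
          -- nonnegative there and the time derivative is at least `ε`.
          have hpos : 0 < d t i + ε := by
            have h1 := hd i hi t ht0 htT
            have h2 := mul_nonneg (ha i) (hall (i + 1))
            have h3 := mul_nonneg (hb i) (hall (i - 1))
            have hw : w t i = -(ε * (1 + t)) := by linarith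
            simp only [birthDeathGen, hw] at h1
            nlinarith
          have hslope := ((hasDerivWithinAt_iff_tendsto_slope' (lt_irrefl t)).1
            (hD.mono Set.Ioi_subset_Ici_self)).eventually (lt_mem_nhds hpos)
          filter_upwards [hslope, self_mem_nhdsWithin] with s hs hst
          rw [slope_def_field, ← hzero, sub_zero] at hs
          have := (div_pos_iff_of_pos_right (sub_pos.2 hst)).1 hs
          exact this.le
      exact (Filter.eventually_all_finset F).2 this
  intro t ht0 htT i
  by_cases hi : i ∈ F
  · refine le_of_forall_pos_le_add fun ε hε => ?_
    have h1 : 0 < 1 + t := by linarith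
    have := main (ε / (1 + t)) (by positivity) t ⟨ht0, htT⟩ i hi
    rwa [div_mul_cancel₀ _ h1.ne'] at this
  · exact hout i hi t ht0 htT

/-- The backward equation on a finite set `F` of sites, with killing outside `F`, is solvable. -/
theorem exists_killed_solution (a b : ℤ → ℝ) (F : Finset ℤ) (f : ℤ → ℝ) :
    ∃ u : ℝ → ℤ → ℝ, (∀ i ∈ F, u 0 i = f i) ∧ (∀ t, ∀ i ∉ F, u t i = 0) ∧
      ∀ t, ∀ i ∈ F, HasDerivAt (fun r => u r i) (birthDeathGen a b (u t) i) t := by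
  classical
  let ext : (F → ℝ) → ℤ → ℝ := fun g i => if hi : i ∈ F then g ⟨i, hi⟩ else 0
  have ext_add : ∀ g g' k, ext (g + g') k = ext g k + ext g' k := by
    intro g g' k; simp only [ext]; split_ifs <;> simp
  have ext_smul : ∀ (c : ℝ) g k, ext (c • g) k = c * ext g k := by
    intro c g k; simp only [ext]; split_ifs <;> simp
  let A₀ : (F → ℝ) →ₗ[ℝ] (F → ℝ) :=
    { toFun := fun g i => birthDeathGen a b (ext g) i
      map_add' := fun g g' => by
        funext i; simp only [Pi.add_apply, birthDeathGen, ext_add]; ring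
      map_smul' := fun c g => by
        funext i
        simp only [Pi.smul_apply, birthDeathGen, ext_smul, smul_eq_mul, RingHom.id_apply]; ring }
  let A : (F → ℝ) →L[ℝ] (F → ℝ) := LinearMap.toContinuousLinearMap A₀
  let g₀ : F → ℝ := fun i => f i
  refine ⟨fun t : ℝ => ext (NormedSpace.exp (t • A) g₀), fun i hi => ?_, fun t i hi => ?_,
    fun t i hi => ?_⟩
  · simp [ext, hi, g₀]
  · simp [ext, hi]
  · have h1 : HasDerivAt (fun r : ℝ => NormedSpace.exp (r • A) g₀)
        ((A * NormedSpace.exp (t • A)) g₀) t := by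
      have := (hasDerivAt_exp_smul_const' (𝕂 := ℝ) A t).clm_apply (hasDerivAt_const t g₀)
      simpa using this
    have h2 := (hasDerivAt_pi.1 h1) ⟨i, hi⟩
    have h3 : (fun r : ℝ => ext (NormedSpace.exp (r • A) g₀) i)
        = fun r : ℝ => NormedSpace.exp (r • A) g₀ ⟨i, hi⟩ := by
      funext r; simp [ext, hi]
    rw [h3]
    exact h2

end

/-! ### The barrier `c (|i| + K t)` and uniqueness for the backward equation -/

section
variable {a b : ℤ → ℝ}

/-- Comparison with the barrier `c (|i| + K t)` on a finite set of sites. -/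
theorem barrier_le_of_finset (hab : ConfiningRates a b) {K : ℝ}
    (hK : ∀ i, birthDeathGen a b (fun k => |(k : ℝ)|) i ≤ K) (F : Finset ℤ)
    {u : ℝ → ℤ → ℝ} {T c : ℝ} (hc : 0 ≤ c)
    (hcont : ∀ i ∈ F, ContinuousOn (fun t => u t i) (Set.Ici 0))
    (hder : ∀ i ∈ F, ∀ t, 0 ≤ t →
      HasDerivWithinAt (fun r => u r i) (birthDeathGen a b (u t) i) (Set.Ici t) t)
    (h0 : ∀ i ∈ F, -(c * |(i : ℝ)|) ≤ u 0 i)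
    (hout : ∀ i ∉ F, ∀ t, 0 ≤ t → t ≤ T → -(c * (|(i : ℝ)| + K * t)) ≤ u t i) :
    ∀ t, 0 ≤ t → t ≤ T → ∀ i : ℤ, -(c * (|(i : ℝ)| + K * t)) ≤ u t i := by
  have := nonneg_of_birthDeathGen_le (fun i => (hab.right_pos i).le) (fun i => (hab.left_pos i).le)
    F (w := fun t i => u t i + c * (|(i : ℝ)| + K * t))
    (d := fun t i => birthDeathGen a b (u t) i + c * K) (T := T) ?_ ?_ ?_ ?_ ?_
  · intro t h1 h2 i
    linarith [this t h1 h2 i]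
  · intro i hi
    exact ((hcont i hi).mono Set.Icc_subset_Ici_self).add (by fun_prop)
  · intro i hi t ht _
    refine (hder i hi t ht).fun_add ?_
    simpa using (((hasDerivWithinAt_id t (Set.Ici t)).const_mul K).const_add |(i : ℝ)|).const_mul c
  · intro i _ t _ _
    have h1 := mul_le_mul_of_nonneg_left (hK i) hc
    simp only [birthDeathGen] at h1 ⊢
    linarith
  · intro i hi
    simpa using by linarith [h0 i hi]
  · intro i hi t h1 h2
    linarith [hout i hi t h1 h2]

/-- A backward solution that is bounded on bounded time intervals stays above the barrier. -/
theorem IsBackwardSol.barrier_le (hab : ConfiningRates a b) {K : ℝ} (hK0 : 0 ≤ K)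
    (hK : ∀ i, birthDeathGen a b (fun k => |(k : ℝ)|) i ≤ K) {u : ℝ → ℤ → ℝ}
    (hu : IsBackwardSol a b u) {T B c : ℝ} (hB : ∀ t, 0 ≤ t → t ≤ T → ∀ i, |u t i| ≤ B)
    (hc : 0 ≤ c) (h0 : ∀ i : ℤ, -(c * |(i : ℝ)|) ≤ u 0 i) :
    ∀ t, 0 ≤ t → t ≤ T → ∀ i : ℤ, -(c * (|(i : ℝ)| + K * t)) ≤ u t i := by
  intro t ht htT i
  have hB0 : 0 ≤ B := (abs_nonneg _).trans (hB t ht htT i)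
  -- The extra slope `B / (N + 1)` lifts the barrier above `B` at all sites with `|k| ≥ N + 1`, so
  -- the comparison on `[-N, N]` applies; then `N → ∞`.
  have key : ∀ N : ℕ, -((c + B / ((N : ℝ) + 1)) * (|(i : ℝ)| + K * t)) ≤ u t i := by
    intro N
    have hN : (0 : ℝ) < (N : ℝ) + 1 := by positivity
    refine barrier_le_of_finset hab hK (Finset.Icc (-(N : ℤ)) N) (u := u) (T := T)
      (by positivity) (fun i _ => hu.continuousOn i) (fun i _ t ht => hu.hasDeriv t ht i) ?_ ?_
      t ht htT i
    · intro k _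
      have : 0 ≤ B / ((N : ℝ) + 1) * |(k : ℝ)| := by positivity
      linarith [h0 k]
    · intro k hk s hs hsT
      have hk' : (N : ℝ) + 1 ≤ |(k : ℝ)| := by
        have : (N : ℤ) + 1 ≤ |k| := by
          by_contra hlt
          exact hk (Finset.mem_Icc.2 (abs_le.1 (by omega)))
        exact_mod_cast this
      have h1 : B ≤ B / ((N : ℝ) + 1) * |(k : ℝ)| := by
        rw [div_mul_eq_mul_div, le_div_iff₀ hN]
        exact mul_le_mul_of_nonneg_left hk' hB0
      have h2 : 0 ≤ B / ((N : ℝ) + 1) * (K * s) := by positivity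
      have h3 : 0 ≤ c * (|(k : ℝ)| + K * s) := by positivity
      have h4 := neg_le_of_abs_le (hB s hs hsT k)
      linarith
  have hlim : Tendsto (fun N : ℕ => -((c + B / ((N : ℝ) + 1)) * (|(i : ℝ)| + K * t))) atTop
      (𝓝 (-((c + 0) * (|(i : ℝ)| + K * t)))) := by
    refine (Tendsto.mul_const _ (Tendsto.const_add _ ?_)).neg
    simpa [div_eq_mul_inv] using (tendsto_one_div_add_atTop_nhds_zero_nat (𝕜 := ℝ)).const_mul B
  rw [add_zero] at hlim
  exact le_of_tendsto hlim (Eventually.of_forall key)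

theorem IsBackwardSol.sub {u v : ℝ → ℤ → ℝ} (hu : IsBackwardSol a b u)
    (hv : IsBackwardSol a b v) : IsBackwardSol a b (fun t i => u t i - v t i) where
  continuousOn i := (hu.continuousOn i).sub (hv.continuousOn i)
  hasDeriv t ht i := by
    rw [birthDeathGen_sub]
    exact (hu.hasDeriv t ht i).fun_sub (hv.hasDeriv t ht i)

theorem IsBackwardSol.neg {u : ℝ → ℤ → ℝ} (hu : IsBackwardSol a b u) :
    IsBackwardSol a b (fun t i => -u t i) where
  continuousOn i := (hu.continuousOn i).neg
  hasDeriv t ht i := by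
    rw [birthDeathGen_neg]
    exact (hu.hasDeriv t ht i).fun_neg

/-- This is the barrier with `c = 0`; the vanishing slope needed at infinity is already absorbed in
`barrier_le`. -/
theorem IsBackwardSol.nonneg (hab : ConfiningRates a b) {u : ℝ → ℤ → ℝ}
    (hu : IsBackwardSol a b u) {T B : ℝ} (hB : ∀ t, 0 ≤ t → t ≤ T → ∀ i, |u t i| ≤ B)
    (h0 : ∀ i, 0 ≤ u 0 i) (t : ℝ) (ht : 0 ≤ t) (htT : t ≤ T) (i : ℤ) : 0 ≤ u t i := by
  obtain ⟨K, hK0, hK⟩ := exists_birthDeathGen_abs_le hab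
  simpa using hu.barrier_le hab hK0 hK hB le_rfl (by simpa using h0) t ht htT i

/-- Bounded solutions of the backward equation are determined by their initial values. -/
theorem IsBackwardSol.unique (hab : ConfiningRates a b) {u v : ℝ → ℤ → ℝ}
    (hu : IsBackwardSol a b u) (hv : IsBackwardSol a b v) {B C : ℝ}
    (hB : ∀ t, 0 ≤ t → ∀ i, |u t i| ≤ B) (hC : ∀ t, 0 ≤ t → ∀ i, |v t i| ≤ C)
    (h0 : ∀ i, u 0 i = v 0 i) (t : ℝ) (ht : 0 ≤ t) (i : ℤ) : u t i = v t i := by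
  have hbd : ∀ t, 0 ≤ t → ∀ i, |u t i - v t i| ≤ B + C := fun t ht i =>
    (abs_sub _ _).trans (add_le_add (hB t ht i) (hC t ht i))
  have h1 := (hu.sub hv).nonneg hab (T := t) (fun t ht _ i => hbd t ht i)
    (by simp [h0]) t ht le_rfl i
  have h2 := (hv.sub hu).nonneg hab (T := t) (B := B + C)
    (fun t ht _ i => by rw [abs_sub_comm]; exact hbd t ht i)
    (by simp [h0]) t ht le_rfl i
  linarith

/-! ### Killed solutions and the semigroup as their limit -/

/-- The solution of the backward equation on `[-N, N]` with killing outside. -/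
noncomputable def killedSol (a b : ℤ → ℝ) (N : ℕ) (f : ℤ → ℝ) : ℝ → ℤ → ℝ :=
  (exists_killed_solution a b (Finset.Icc (-(N : ℤ)) N) f).choose

theorem killedSol_zero (N : ℕ) (f : ℤ → ℝ) {i : ℤ} (hi : |i| ≤ N) :
    killedSol a b N f 0 i = f i :=
  (exists_killed_solution a b (Finset.Icc (-(N : ℤ)) N) f).choose_spec.1 i
    (Finset.mem_Icc.2 (abs_le.1 hi))

theorem killedSol_of_lt (N : ℕ) (f : ℤ → ℝ) (t : ℝ) {i : ℤ} (hi : (N : ℤ) < |i|) :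
    killedSol a b N f t i = 0 :=
  (exists_killed_solution a b (Finset.Icc (-(N : ℤ)) N) f).choose_spec.2.1 t i
    fun h => not_le.2 hi (abs_le.2 (Finset.mem_Icc.1 h))

theorem killedSol_hasDerivAt (N : ℕ) (f : ℤ → ℝ) (t : ℝ) {i : ℤ} (hi : |i| ≤ N) :
    HasDerivAt (fun r => killedSol a b N f r i) (birthDeathGen a b (killedSol a b N f t) i) t :=
  (exists_killed_solution a b (Finset.Icc (-(N : ℤ)) N) f).choose_spec.2.2 t i
    (Finset.mem_Icc.2 (abs_le.1 hi))

theorem abs_le_of_mem_Icc {N : ℕ} {i : ℤ} (hi : i ∈ Finset.Icc (-(N : ℤ)) N) : |i| ≤ N :=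
  abs_le.2 (Finset.mem_Icc.1 hi)

theorem lt_abs_of_notMem_Icc {N : ℕ} {i : ℤ} (hi : i ∉ Finset.Icc (-(N : ℤ)) N) :
    (N : ℤ) < |i| := by
  by_contra h
  exact hi (Finset.mem_Icc.2 (abs_le.1 (not_lt.1 h)))

/-- Maximum principle on `[-N, N]` for two-sided differentiable solutions. -/
theorem nonneg_of_hasDerivAt_birthDeathGen (hab : ConfiningRates a b) (N : ℕ) {w : ℝ → ℤ → ℝ}
    (hder : ∀ t, 0 ≤ t → ∀ i : ℤ, |i| ≤ N →
      HasDerivAt (fun r => w r i) (birthDeathGen a b (w t) i) t)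
    (h0 : ∀ i : ℤ, |i| ≤ N → 0 ≤ w 0 i)
    (hout : ∀ t, 0 ≤ t → ∀ i : ℤ, (N : ℤ) < |i| → 0 ≤ w t i) (t : ℝ) (ht : 0 ≤ t) (i : ℤ) :
    0 ≤ w t i :=
  nonneg_of_birthDeathGen_le (fun i => (hab.right_pos i).le) (fun i => (hab.left_pos i).le)
    (Finset.Icc (-(N : ℤ)) N) (d := fun t i => birthDeathGen a b (w t) i) (T := t)
    (fun i hi s hs => (hder s hs.1 i (abs_le_of_mem_Icc hi)).continuousAt.continuousWithinAt)
    (fun i hi s hs _ => (hder s hs i (abs_le_of_mem_Icc hi)).hasDerivWithinAt)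
    (fun _ _ _ _ _ => le_rfl) (fun i hi => h0 i (abs_le_of_mem_Icc hi))
    (fun i hi s hs _ => hout s hs i (lt_abs_of_notMem_Icc hi)) t ht le_rfl i

theorem killedSol_nonneg (hab : ConfiningRates a b) (N : ℕ) {f : ℤ → ℝ} (hf : ∀ i, 0 ≤ f i)
    (t : ℝ) (ht : 0 ≤ t) (i : ℤ) : 0 ≤ killedSol a b N f t i :=
  nonneg_of_hasDerivAt_birthDeathGen hab N (fun t _ i hi => killedSol_hasDerivAt N f t hi)
    (fun i hi => by rw [killedSol_zero N f hi]; exact hf i)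
    (fun t _ i hi => (killedSol_of_lt N f t hi).ge) t ht i

theorem abs_killedSol_le (hab : ConfiningRates a b) (N : ℕ) {f : ℤ → ℝ} {B : ℝ}
    (hf : ∀ i, |f i| ≤ B) (t : ℝ) (ht : 0 ≤ t) (i : ℤ) : |killedSol a b N f t i| ≤ B := by
  have hB : 0 ≤ B := (abs_nonneg _).trans (hf 0)
  have h1 := nonneg_of_hasDerivAt_birthDeathGen hab N (w := fun t i => B - killedSol a b N f t i)
    (fun t _ i hi => by
      rw [birthDeathGen_sub, birthDeathGen_const]
      simpa using (killedSol_hasDerivAt N f t hi).const_sub B)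
    (fun i hi => by
      rw [killedSol_zero N f hi]; linarith [le_of_abs_le (hf i)])
    (fun t _ i hi => by rw [killedSol_of_lt N f t hi]; linarith) t ht i
  have h2 := nonneg_of_hasDerivAt_birthDeathGen hab N (w := fun t i => B + killedSol a b N f t i)
    (fun t _ i hi => by
      rw [birthDeathGen_add, birthDeathGen_const]
      simpa using (killedSol_hasDerivAt N f t hi).const_add B)
    (fun i hi => by
      rw [killedSol_zero N f hi]; linarith [neg_le_of_abs_le (hf i)])
    (fun t _ i hi => by rw [killedSol_of_lt N f t hi]; linarith) t ht i
  exact abs_le.2 ⟨by linarith, by linarith⟩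

theorem le_div_mul_of_lt_abs {B K t : ℝ} (hB : 0 ≤ B) (hK : 0 ≤ K) (ht : 0 ≤ t) {N : ℕ} {i : ℤ}
    (hi : (N : ℤ) < |i|) : B ≤ B / ((N : ℝ) + 1) * (|(i : ℝ)| + K * t) := by
  have hN : (0 : ℝ) < (N : ℝ) + 1 := by positivity
  have hi' : (N : ℝ) + 1 ≤ |(i : ℝ)| := by exact_mod_cast hi
  rw [div_mul_eq_mul_div, le_div_iff₀ hN]
  exact mul_le_mul_of_nonneg_left (by nlinarith) hB

/-- The killed solutions form a Cauchy sequence, locally uniformly in time. -/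
theorem abs_killedSol_sub_le (hab : ConfiningRates a b) {K : ℝ} (hK0 : 0 ≤ K)
    (hK : ∀ i, birthDeathGen a b (fun k => |(k : ℝ)|) i ≤ K) {f : ℤ → ℝ} {B : ℝ}
    (hf : ∀ i, |f i| ≤ B) {N M : ℕ} (hNM : N ≤ M) (t : ℝ) (ht : 0 ≤ t) (i : ℤ) :
    |killedSol a b N f t i - killedSol a b M f t i|
      ≤ B / ((N : ℝ) + 1) * (|(i : ℝ)| + K * t) := by
  have hB : 0 ≤ B := (abs_nonneg _).trans (hf 0)
  have hc : 0 ≤ B / ((N : ℝ) + 1) := by positivity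
  have hM : ∀ {i : ℤ}, |i| ≤ (N : ℤ) → |i| ≤ (M : ℤ) := fun h => h.trans (by exact_mod_cast hNM)
  have hd1 : ∀ t, ∀ i ∈ Finset.Icc (-(N : ℤ)) N, HasDerivAt
      (fun r => killedSol a b N f r i - killedSol a b M f r i)
      (birthDeathGen a b (fun k => killedSol a b N f t k - killedSol a b M f t k) i) t :=
    fun t i hi => by
      rw [birthDeathGen_sub]
      exact (killedSol_hasDerivAt N f t (abs_le_of_mem_Icc hi)).fun_sub
        (killedSol_hasDerivAt M f t (hM (abs_le_of_mem_Icc hi)))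
  have hd2 : ∀ t, ∀ i ∈ Finset.Icc (-(N : ℤ)) N, HasDerivAt
      (fun r => killedSol a b M f r i - killedSol a b N f r i)
      (birthDeathGen a b (fun k => killedSol a b M f t k - killedSol a b N f t k) i) t :=
    fun t i hi => by
      rw [birthDeathGen_sub]
      exact (killedSol_hasDerivAt M f t (hM (abs_le_of_mem_Icc hi))).fun_sub
        (killedSol_hasDerivAt N f t (abs_le_of_mem_Icc hi))
  have h1 := barrier_le_of_finset hab hK (Finset.Icc (-(N : ℤ)) N)
    (u := fun t i => killedSol a b N f t i - killedSol a b M f t i) (T := t) hc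
    (fun i hi s _ => (hd1 s i hi).continuousAt.continuousWithinAt)
    (fun i hi s _ => (hd1 s i hi).hasDerivWithinAt)
    (fun i hi => by
      rw [killedSol_zero N f (abs_le_of_mem_Icc hi), killedSol_zero M f (hM (abs_le_of_mem_Icc hi))]
      simp only [sub_self, Left.neg_nonpos_iff]; positivity)
    (fun i hi s hs _ => by
      have h := lt_abs_of_notMem_Icc hi
      rw [killedSol_of_lt N f s h]
      linarith [le_div_mul_of_lt_abs hB hK0 hs h, le_of_abs_le (abs_killedSol_le hab M hf s hs i)])
    t ht le_rfl i
  have h2 := barrier_le_of_finset hab hK (Finset.Icc (-(N : ℤ)) N)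
    (u := fun t i => killedSol a b M f t i - killedSol a b N f t i) (T := t) hc
    (fun i hi s _ => (hd2 s i hi).continuousAt.continuousWithinAt)
    (fun i hi s _ => (hd2 s i hi).hasDerivWithinAt)
    (fun i hi => by
      rw [killedSol_zero N f (abs_le_of_mem_Icc hi), killedSol_zero M f (hM (abs_le_of_mem_Icc hi))]
      simp only [sub_self, Left.neg_nonpos_iff]; positivity)
    (fun i hi s hs _ => by
      have h := lt_abs_of_notMem_Icc hi
      rw [killedSol_of_lt N f s h]
      linarith [le_div_mul_of_lt_abs hB hK0 hs h, neg_le_of_abs_le (abs_killedSol_le hab M hf s hs i)])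
    t ht le_rfl i
  exact abs_le.2 ⟨by linarith, by linarith⟩

/-- The Markov semigroup of the birth-death process acting on bounded functions. -/
noncomputable def birthDeathSemigroup (a b : ℤ → ℝ) (f : ℤ → ℝ) (t : ℝ) (i : ℤ) : ℝ :=
  limUnder atTop fun N => killedSol a b N f t i

theorem tendsto_div_nat_add_one_mul (B D : ℝ) :
    Tendsto (fun N : ℕ => B / ((N : ℝ) + 1) * D) atTop (𝓝 0) := by
  have := ((tendsto_one_div_add_atTop_nhds_zero_nat (𝕜 := ℝ)).const_mul B).mul_const D
  simpa [div_eq_mul_inv] using this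

theorem tendsto_killedSol (hab : ConfiningRates a b) {f : ℤ → ℝ} {B : ℝ}
    (hf : ∀ i, |f i| ≤ B) (t : ℝ) (ht : 0 ≤ t) (i : ℤ) :
    Tendsto (fun N => killedSol a b N f t i) atTop (𝓝 (birthDeathSemigroup a b f t i)) := by
  obtain ⟨K, hK0, hK⟩ := exists_birthDeathGen_abs_le hab
  refine CauchySeq.tendsto_limUnder ?_
  refine cauchySeq_of_le_tendsto_0' (fun N : ℕ => B / ((N : ℝ) + 1) * (|(i : ℝ)| + K * t)) ?_
    (tendsto_div_nat_add_one_mul _ _)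
  intro N M hNM
  rw [Real.dist_eq]
  exact abs_killedSol_sub_le hab hK0 hK hf hNM t ht i

theorem abs_killedSol_sub_semigroup_le (hab : ConfiningRates a b) {K : ℝ} (hK0 : 0 ≤ K)
    (hK : ∀ i, birthDeathGen a b (fun k => |(k : ℝ)|) i ≤ K) {f : ℤ → ℝ} {B : ℝ}
    (hf : ∀ i, |f i| ≤ B) (N : ℕ) (t : ℝ) (ht : 0 ≤ t) (i : ℤ) :
    |killedSol a b N f t i - birthDeathSemigroup a b f t i|
      ≤ B / ((N : ℝ) + 1) * (|(i : ℝ)| + K * t) :=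
  le_of_tendsto ((tendsto_killedSol hab hf t ht i).const_sub _).abs
    ((eventually_ge_atTop N).mono fun _ hM => abs_killedSol_sub_le hab hK0 hK hf hM t ht i)

theorem abs_semigroup_le (hab : ConfiningRates a b) {f : ℤ → ℝ} {B : ℝ}
    (hf : ∀ i, |f i| ≤ B) (t : ℝ) (ht : 0 ≤ t) (i : ℤ) : |birthDeathSemigroup a b f t i| ≤ B :=
  le_of_tendsto (tendsto_killedSol hab hf t ht i).abs
    (Eventually.of_forall fun N => abs_killedSol_le hab N hf t ht i)

theorem semigroup_zero (hab : ConfiningRates a b) {f : ℤ → ℝ} {B : ℝ}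
    (hf : ∀ i, |f i| ≤ B) (i : ℤ) : birthDeathSemigroup a b f 0 i = f i := by
  refine tendsto_nhds_unique (tendsto_killedSol hab hf 0 le_rfl i) ?_
  refine tendsto_const_nhds.congr' ?_
  filter_upwards [eventually_ge_atTop i.natAbs] with N hN
  rw [killedSol_zero]
  rw [Int.abs_eq_natAbs]
  omega

theorem abs_birthDeathGen_le (hab : ConfiningRates a b) {u : ℤ → ℝ} {i : ℤ} {e : ℝ}
    (h1 : |u (i + 1)| ≤ e) (h2 : |u i| ≤ e) (h3 : |u (i - 1)| ≤ e) :
    |birthDeathGen a b u i| ≤ 2 * (a i + b i) * e := by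
  have ha := hab.right_pos i
  have hb := hab.left_pos i
  simp only [birthDeathGen]
  refine (abs_add_le _ _).trans ?_
  rw [abs_mul, abs_mul, abs_of_pos ha, abs_of_pos hb]
  have h4 : |u (i + 1) - u i| ≤ 2 * e := (abs_sub _ _).trans (by linarith)
  have h5 : |u (i - 1) - u i| ≤ 2 * e := (abs_sub _ _).trans (by linarith)
  have := mul_le_mul_of_nonneg_left h4 ha.le
  have := mul_le_mul_of_nonneg_left h5 hb.le
  linarith

theorem tendstoUniformlyOn_of_abs_sub_le {ι α : Type*} {l : Filter ι} {F : ι → α → ℝ}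
    {G : α → ℝ} {s : Set α} {e : ι → ℝ} (he : Tendsto e l (𝓝 0))
    (h : ∀ n, ∀ x ∈ s, |F n x - G x| ≤ e n) : TendstoUniformlyOn F G l s := by
  rw [Metric.tendstoUniformlyOn_iff]
  intro ε hε
  filter_upwards [he.eventually (gt_mem_nhds hε)] with n hn x hx
  rw [dist_comm, Real.dist_eq]
  exact (h n x hx).trans_lt hn

/-- The generator at `i` sees only three sites, and the killing error is uniform there for bounded
times, so the backward equation passes to the limit. -/
theorem semigroup_hasDerivWithinAt (hab : ConfiningRates a b) {f : ℤ → ℝ} {B : ℝ}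
    (hf : ∀ i, |f i| ≤ B) (t : ℝ) (ht : 0 ≤ t) (i : ℤ) :
    HasDerivWithinAt (fun r => birthDeathSemigroup a b f r i)
      (birthDeathGen a b (birthDeathSemigroup a b f t) i) (Set.Ici 0) t := by
  obtain ⟨K, hK0, hK⟩ := exists_birthDeathGen_abs_le hab
  have hB : 0 ≤ B := (abs_nonneg _).trans (hf 0)
  -- The shift by `|i|` keeps `i` inside the box for every index, so that each approximant solves
  -- its equation at `i`.
  have hshift : Tendsto (fun N : ℕ => N + i.natAbs) atTop atTop := tendsto_add_atTop_nat _
  refine hasDerivWithinAt_Ici_of_tendstoUniformlyOn (l := atTop)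
    (F := fun N r => killedSol a b (N + i.natAbs) f r i)
    (F' := fun N r => birthDeathGen a b (killedSol a b (N + i.natAbs) f r) i)
    (G' := fun r => birthDeathGen a b (birthDeathSemigroup a b f r) i) ?_ ?_ ?_ t ht
  · intro N s _
    exact (killedSol_hasDerivAt _ f s (by rw [Int.abs_eq_natAbs]; omega)).hasDerivWithinAt
  · intro s hs
    exact (tendsto_killedSol hab hf s hs i).comp hshift
  · intro T hT
    refine tendstoUniformlyOn_of_abs_sub_le
      (e := fun N => 2 * (a i + b i) *
        (B / (((N + i.natAbs : ℕ) : ℝ) + 1) * (|(i : ℝ)| + 1 + K * T))) ?_ ?_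
    · simpa using ((tendsto_div_nat_add_one_mul B (|(i : ℝ)| + 1 + K * T)).comp hshift).const_mul
        (2 * (a i + b i))
    · rintro N s ⟨hs0, hsT⟩
      rw [← birthDeathGen_sub]
      have hkey : ∀ k : ℤ, |(k : ℝ)| ≤ |(i : ℝ)| + 1 →
          |killedSol a b (N + i.natAbs) f s k - birthDeathSemigroup a b f s k|
            ≤ B / (((N + i.natAbs : ℕ) : ℝ) + 1) * (|(i : ℝ)| + 1 + K * T) := by
        intro k hk
        refine (abs_killedSol_sub_semigroup_le hab hK0 hK hf _ s hs0 k).trans ?_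
        have : K * s ≤ K * T := mul_le_mul_of_nonneg_left hsT.le hK0
        exact mul_le_mul_of_nonneg_left (by linarith) (by positivity)
      refine abs_birthDeathGen_le hab (hkey _ ?_) (hkey _ (by linarith)) (hkey _ ?_)
      · push_cast
        simpa using abs_add_le (i : ℝ) 1
      · push_cast
        simpa using abs_sub (i : ℝ) 1

theorem semigroup_isBackwardSol (hab : ConfiningRates a b) {f : ℤ → ℝ} {B : ℝ}
    (hf : ∀ i, |f i| ≤ B) : IsBackwardSol a b (birthDeathSemigroup a b f) where
  continuousOn i t ht := (semigroup_hasDerivWithinAt hab hf t ht i).continuousWithinAt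
  hasDeriv t ht i := (semigroup_hasDerivWithinAt hab hf t ht i).mono (Set.Ici_subset_Ici.2 ht)

/-- Any bounded backward solution is given by the semigroup. -/
theorem IsBackwardSol.eq_semigroup (hab : ConfiningRates a b) {u : ℝ → ℤ → ℝ}
    (hu : IsBackwardSol a b u) {f : ℤ → ℝ} (h0 : ∀ i, u 0 i = f i) {B : ℝ}
    (hB : ∀ t, 0 ≤ t → ∀ i, |u t i| ≤ B) (t : ℝ) (ht : 0 ≤ t) (i : ℤ) :
    u t i = birthDeathSemigroup a b f t i := by
  have hf : ∀ i, |f i| ≤ B := fun i => h0 i ▸ hB 0 le_rfl i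
  exact hu.unique hab (semigroup_isBackwardSol hab hf) hB (abs_semigroup_le hab hf)
    (fun i => by rw [h0, semigroup_zero hab hf]) t ht i

end

/-! ### Transition probabilities and Chapman-Kolmogorov -/

/-- The transition probabilities `ℙ(Z(t) = j | Z(0) = i)` of the birth-death process. -/
noncomputable def birthDeathTransition (a b : ℤ → ℝ) (t : ℝ) (i j : ℤ) : ℝ :=
  birthDeathSemigroup a b (fun k => if k = j then 1 else 0) t i

section
variable {a b : ℤ → ℝ}

theorem IsBackwardSol.const_mul {u : ℝ → ℤ → ℝ} (hu : IsBackwardSol a b u) (c : ℝ) :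
    IsBackwardSol a b (fun t i => c * u t i) where
  continuousOn i := continuousOn_const.mul (hu.continuousOn i)
  hasDeriv t ht i := by
    rw [birthDeathGen_const_mul]
    exact (hu.hasDeriv t ht i).const_mul c

theorem IsBackwardSol.sub_sum {u : ℝ → ℤ → ℝ} (hu : IsBackwardSol a b u) (c : ℤ → ℝ)
    {v : ℤ → ℝ → ℤ → ℝ} (hv : ∀ j, IsBackwardSol a b (v j)) (S : Finset ℤ) :
    IsBackwardSol a b (fun t i => u t i - ∑ j ∈ S, c j * v j t i) := by
  classical
  induction S using Finset.induction_on with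
  | empty => simpa using hu
  | insert j S hj ih =>
    have := ih.sub ((hv j).const_mul (c j))
    simp only [Finset.sum_insert hj]
    convert this using 3
    ring

theorem abs_indicator_le (j k : ℤ) : |if k = j then (1 : ℝ) else 0| ≤ 1 := by
  split_ifs <;> simp

theorem transition_isBackwardSol (hab : ConfiningRates a b) (j : ℤ) :
    IsBackwardSol a b (fun t i => birthDeathTransition a b t i j) :=
  semigroup_isBackwardSol hab (abs_indicator_le j)

theorem abs_transition_le_one (hab : ConfiningRates a b) (t : ℝ) (ht : 0 ≤ t) (i j : ℤ) :
    |birthDeathTransition a b t i j| ≤ 1 :=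
  abs_semigroup_le hab (abs_indicator_le j) t ht i

theorem transition_zero (hab : ConfiningRates a b) (i j : ℤ) :
    birthDeathTransition a b 0 i j = if i = j then 1 else 0 :=
  semigroup_zero hab (abs_indicator_le j) i

theorem transition_nonneg (hab : ConfiningRates a b) (t : ℝ) (ht : 0 ≤ t) (i j : ℤ) :
    0 ≤ birthDeathTransition a b t i j :=
  (transition_isBackwardSol hab j).nonneg hab (T := t)
    (fun t ht _ i => abs_transition_le_one hab t ht i j)
    (fun i => by rw [transition_zero hab]; split_ifs <;> simp) t ht le_rfl i

theorem transition_le_one (hab : ConfiningRates a b) (t : ℝ) (ht : 0 ≤ t) (i j : ℤ) :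
    birthDeathTransition a b t i j ≤ 1 :=
  le_of_abs_le (abs_transition_le_one hab t ht i j)

/-- The remainder after a finite partial sum is a bounded backward solution whose initial value
vanishes on `S` and is at most `B` elsewhere. If `S` contains `[-N, N]`, that initial value lies
below `B / (N + 1) * |k|`, and the barrier carries the bound to time `t`. -/
theorem hasSum_mul_transition (hab : ConfiningRates a b) {f : ℤ → ℝ} {B : ℝ}
    (hf : ∀ i, |f i| ≤ B) (t : ℝ) (ht : 0 ≤ t) (i : ℤ) :
    HasSum (fun j => f j * birthDeathTransition a b t i j) (birthDeathSemigroup a b f t i) := by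
  obtain ⟨K, hK0, hK⟩ := exists_birthDeathGen_abs_le hab
  have hB : 0 ≤ B := (abs_nonneg _).trans (hf 0)
  have key : ∀ (N : ℕ) (S : Finset ℤ), Finset.Icc (-(N : ℤ)) N ⊆ S →
      |birthDeathSemigroup a b f t i - ∑ j ∈ S, f j * birthDeathTransition a b t i j|
        ≤ B / ((N : ℝ) + 1) * (|(i : ℝ)| + K * t) := by
    intro N S hS
    set v : ℝ → ℤ → ℝ := fun t i =>
      birthDeathSemigroup a b f t i - ∑ j ∈ S, f j * birthDeathTransition a b t i j with hv
    have hsol : IsBackwardSol a b v :=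
      (semigroup_isBackwardSol hab hf).sub_sum f (transition_isBackwardSol hab) S
    have hbd : ∀ s, 0 ≤ s → s ≤ t → ∀ k, |v s k| ≤ B + ∑ j ∈ S, |f j| := by
      intro s hs _ k
      refine (abs_sub _ _).trans (add_le_add (abs_semigroup_le hab hf s hs k) ?_)
      refine (Finset.abs_sum_le_sum_abs _ _).trans (Finset.sum_le_sum fun j _ => ?_)
      rw [abs_mul]
      exact mul_le_of_le_one_right (abs_nonneg _) (abs_transition_le_one hab s hs k j)
    have h0 : ∀ k, |v 0 k| ≤ B / ((N : ℝ) + 1) * |(k : ℝ)| := by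
      intro k
      simp only [hv, semigroup_zero hab hf, transition_zero hab, mul_ite, mul_one, mul_zero,
        Finset.sum_ite_eq]
      split_ifs with hk
      · simp only [sub_self, abs_zero]; positivity
      · have := le_div_mul_of_lt_abs hB hK0 le_rfl (lt_abs_of_notMem_Icc fun h => hk (hS h))
        simpa using (hf k).trans this
    have hc : 0 ≤ B / ((N : ℝ) + 1) := by positivity
    have h1 := hsol.barrier_le hab hK0 hK hbd hc (fun k => neg_le_of_abs_le (h0 k)) t ht le_rfl i
    have h2 := hsol.neg.barrier_le hab hK0 hK (B := B + ∑ j ∈ S, |f j|)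
      (fun s hs hst k => by rw [abs_neg]; exact hbd s hs hst k) hc
      (fun k => by linarith [le_of_abs_le (h0 k)]) t ht le_rfl i
    exact abs_le.2 ⟨by linarith, by linarith⟩
  rw [HasSum, SummationFilter.unconditional_filter, Metric.tendsto_atTop]
  intro ε hε
  obtain ⟨N, hN⟩ := ((tendsto_div_nat_add_one_mul B (|(i : ℝ)| + K * t)).eventually
    (gt_mem_nhds hε)).exists
  refine ⟨Finset.Icc (-(N : ℤ)) N, fun S hS => ?_⟩
  rw [dist_comm, Real.dist_eq]
  exact (key N S hS).trans_lt hN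

/-- The constant `1` is a bounded backward solution, so by uniqueness the semigroup preserves it: no
mass escapes to infinity. -/
theorem hasSum_transition (hab : ConfiningRates a b) (t : ℝ) (ht : 0 ≤ t) (i : ℤ) :
    HasSum (fun j => birthDeathTransition a b t i j) 1 := by
  have hconst : IsBackwardSol a b (fun _ _ => 1) :=
    ⟨fun _ => continuousOn_const, fun t _ i => by
      rw [birthDeathGen_const]; exact hasDerivWithinAt_const _ _ _⟩
  have h1 := hconst.eq_semigroup hab (f := fun _ => 1) (fun _ => rfl) (B := 1) (by simp) t ht i
  have h2 := hasSum_mul_transition hab (f := fun _ => 1) (B := 1) (by simp) t ht i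
  rw [← h1] at h2
  simpa using h2

/-- Shifting time by `t` gives a bounded backward solution started from `p_t(·, j)`; uniqueness
identifies it with the semigroup applied to that function. -/
theorem transition_chapman_kolmogorov (hab : ConfiningRates a b) (s t : ℝ) (hs : 0 ≤ s)
    (ht : 0 ≤ t) (i j : ℤ) :
    HasSum (fun k => birthDeathTransition a b s i k * birthDeathTransition a b t k j)
      (birthDeathTransition a b (s + t) i j) := by
  have hbd := fun k => abs_transition_le_one hab t ht k j
  have hshift : IsBackwardSol a b (fun r k => birthDeathTransition a b (r + t) k j) := by
    refine ⟨fun k => ?_, fun r hr k => ?_⟩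
    · exact ((transition_isBackwardSol hab j).continuousOn k).comp (by fun_prop)
        fun r hr => Set.mem_Ici.2 (add_nonneg hr ht)
    · have h1 := (transition_isBackwardSol hab j).hasDeriv (r + t) (add_nonneg hr ht) k
      have h2 := h1.scomp r (h := fun r => r + t) (h' := 1) (s := Set.Ici r)
        ((hasDerivWithinAt_id r _).add_const t) (fun x hx => by simpa using hx)
      simpa [Function.comp_def] using h2
  have h1 : birthDeathTransition a b (s + t) i j =
      birthDeathSemigroup a b (fun k => birthDeathTransition a b t k j) s i :=
    hshift.eq_semigroup hab (f := fun k => birthDeathTransition a b t k j) (by simp)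
    (B := 1) (fun r hr k => abs_transition_le_one hab _ (add_nonneg hr ht) k j) s hs i
  have h2 := hasSum_mul_transition hab hbd s hs i
  rw [← h1] at h2
  simpa only [mul_comm] using h2

/-! ### From the backward to the forward equation -/

/-- The generator of a point mass, paired with `p`, is the adjoint generator of `p`. -/
theorem hasSum_birthDeathGen_indicator_mul (p : ℤ → ℝ) (j : ℤ) :
    HasSum (fun k => birthDeathGen a b (fun l => if l = j then 1 else 0) k * p k)
      (birthDeathFwd a b p j) := by
  have h : birthDeathFwd a b p j = ∑ k ∈ {j - 1, j, j + 1},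
      birthDeathGen a b (fun l => if l = j then 1 else 0) k * p k := by
    rw [Finset.sum_insert, Finset.sum_insert, Finset.sum_singleton]
    · simp only [birthDeathGen, birthDeathFwd]
      have h1 : j - 1 ≠ j := by omega
      have h2 : j - 1 - 1 ≠ j := by omega
      have h3 : j + 1 ≠ j := by omega
      have h4 : j + 1 + 1 ≠ j := by omega
      simp only [h1, h2, h3, h4, sub_add_cancel, add_sub_cancel_right, if_true, if_false]
      ring
    · simp
    · simp; omega
  rw [h]
  refine hasSum_sum_of_ne_finset_zero fun k hk => ?_
  simp only [Finset.mem_insert, Finset.mem_singleton, not_or] at hk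
  have h1 : k + 1 ≠ j := by omega
  have h3 : k - 1 ≠ j := by omega
  simp [birthDeathGen, h1, h3, hk.2.1]

theorem exists_abs_birthDeathGen_indicator_le (hab : ConfiningRates a b) (j : ℤ) :
    ∃ G, ∀ k, |birthDeathGen a b (fun l => if l = j then 1 else 0) k| ≤ G := by
  refine ⟨(a (j - 1) + b (j - 1)) + (a j + b j) + (a (j + 1) + b (j + 1)), fun k => ?_⟩
  have ha := hab.right_pos
  have hb := hab.left_pos
  have h1 := ha (j - 1)
  have h2 := ha j
  have h3 := ha (j + 1)
  have h4 := hb (j - 1)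
  have h5 := hb j
  have h6 := hb (j + 1)
  by_cases hk1 : k = j - 1
  · subst hk1
    have e1 : j - 1 ≠ j := by omega
    have e2 : j - 1 - 1 ≠ j := by omega
    simp [birthDeathGen, e1, e2]
    rw [abs_of_pos h1]; linarith
  by_cases hk2 : k = j
  · subst hk2
    simp only [birthDeathGen, add_eq_left, one_ne_zero, if_false, if_true, sub_eq_self, zero_sub]
    rw [abs_of_neg (by linarith)]; linarith
  by_cases hk3 : k = j + 1
  · subst hk3
    have e1 : j + 1 + 1 ≠ j := by omega
    simp [birthDeathGen, e1]
    rw [abs_of_pos h6]; linarith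
  have e1 : k + 1 ≠ j := by omega
  have e2 : k - 1 ≠ j := by omega
  simp [birthDeathGen, e1, e2, hk2]
  linarith

/-- Killing commutes with the generator on point masses inside `[-N, N]`. -/
theorem birthDeathGen_killedSol_indicator (hab : ConfiningRates a b) {N : ℕ} {j : ℤ}
    (hj : |j| ≤ N) (t : ℝ) (ht : 0 ≤ t) {i : ℤ} (hi : |i| ≤ N) :
    birthDeathGen a b (killedSol a b N (fun k => if k = j then 1 else 0) t) i
      = killedSol a b N (birthDeathGen a b (fun k => if k = j then 1 else 0)) t i := by
  set f : ℤ → ℝ := fun k => if k = j then 1 else 0 with hf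
  -- `w` is the time derivative of the killed solution, zero outside the box included.
  -- Differentiating the linear system once more shows that `w` solves the same killed equation.
  set w : ℝ → ℤ → ℝ := fun t i =>
    if |i| ≤ N then birthDeathGen a b (killedSol a b N f t) i else 0 with hw
  have hinit : killedSol a b N f 0 = f := by
    funext k
    by_cases hk : |k| ≤ N
    · exact killedSol_zero N f hk
    · rw [killedSol_of_lt N f 0 (not_le.1 hk), hf]
      have : k ≠ j := by rintro rfl; exact hk hj
      simp [this]
  have hder : ∀ t k, HasDerivAt (fun r => killedSol a b N f r k) (w t k) t := by
    intro t k
    by_cases hk : |k| ≤ N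
    · simpa [hw, hk] using killedSol_hasDerivAt N f t hk
    · have : (fun r => killedSol a b N f r k) = fun _ => 0 :=
        funext fun r => killedSol_of_lt N f r (not_le.1 hk)
      rw [this]
      simpa [hw, hk] using hasDerivAt_const t (0 : ℝ)
  have hwder : ∀ t, ∀ k : ℤ, |k| ≤ N →
      HasDerivAt (fun r => w r k) (birthDeathGen a b (w t) k) t := by
    intro t k hk
    have : (fun r => w r k) = fun r => birthDeathGen a b (killedSol a b N f r) k := by
      funext r; simp [hw, hk]
    rw [this]
    exact (((hder t (k + 1)).fun_sub (hder t k)).const_mul (a k)).fun_add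
      (((hder t (k - 1)).fun_sub (hder t k)).const_mul (b k))
  have hw0 : ∀ k : ℤ, |k| ≤ N → w 0 k = birthDeathGen a b f k := by
    intro k hk
    simp only [hw, hk, if_true, hinit]
  have hwout : ∀ t, ∀ k : ℤ, (N : ℤ) < |k| → w t k = 0 := by
    intro t k hk
    simp [hw, not_le.2 hk]
  have h1 := nonneg_of_hasDerivAt_birthDeathGen hab N
    (w := fun t k => w t k - killedSol a b N (birthDeathGen a b f) t k)
    (fun t _ k hk => by
      rw [birthDeathGen_sub]
      exact (hwder t k hk).fun_sub (killedSol_hasDerivAt N _ t hk))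
    (fun k hk => by rw [hw0 k hk, killedSol_zero N _ hk, sub_self])
    (fun t _ k hk => by rw [hwout t k hk, killedSol_of_lt N _ t hk, sub_self]) t ht i
  have h2 := nonneg_of_hasDerivAt_birthDeathGen hab N
    (w := fun t k => killedSol a b N (birthDeathGen a b f) t k - w t k)
    (fun t _ k hk => by
      rw [birthDeathGen_sub]
      exact (killedSol_hasDerivAt N _ t hk).fun_sub (hwder t k hk))
    (fun k hk => by rw [hw0 k hk, killedSol_zero N _ hk, sub_self])
    (fun t _ k hk => by rw [hwout t k hk, killedSol_of_lt N _ t hk, sub_self]) t ht i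
  have h3 : w t i = birthDeathGen a b (killedSol a b N f t) i := by simp [hw, hi]
  rw [← h3]
  linarith

theorem tendsto_birthDeathGen {ι : Type*} {l : Filter ι} {u : ι → ℤ → ℝ} {v : ℤ → ℝ}
    (h : ∀ k, Tendsto (fun n => u n k) l (𝓝 (v k))) (i : ℤ) :
    Tendsto (fun n => birthDeathGen a b (u n) i) l (𝓝 (birthDeathGen a b v i)) :=
  (((h (i + 1)).sub (h i)).const_mul _).add (((h (i - 1)).sub (h i)).const_mul _)

theorem birthDeathGen_transition_eq_semigroup (hab : ConfiningRates a b) (t : ℝ) (ht : 0 ≤ t)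
    (i j : ℤ) :
    birthDeathGen a b (fun k => birthDeathTransition a b t k j) i
      = birthDeathSemigroup a b (birthDeathGen a b (fun k => if k = j then 1 else 0)) t i := by
  obtain ⟨G, hG⟩ := exists_abs_birthDeathGen_indicator_le hab j
  refine tendsto_nhds_unique
    (tendsto_birthDeathGen (fun k => tendsto_killedSol hab (abs_indicator_le j) t ht k) i) ?_
  refine (tendsto_killedSol hab hG t ht i).congr' ?_
  filter_upwards [eventually_ge_atTop (i.natAbs + j.natAbs)] with N hN
  refine (birthDeathGen_killedSol_indicator hab ?_ t ht ?_).symm <;>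
  · rw [Int.abs_eq_natAbs]; omega

theorem birthDeathGen_transition_eq_fwd (hab : ConfiningRates a b) (t : ℝ) (ht : 0 ≤ t)
    (i j : ℤ) :
    birthDeathGen a b (fun k => birthDeathTransition a b t k j) i
      = birthDeathFwd a b (birthDeathTransition a b t i) j := by
  obtain ⟨G, hG⟩ := exists_abs_birthDeathGen_indicator_le hab j
  rw [birthDeathGen_transition_eq_semigroup hab t ht i j]
  exact (hasSum_mul_transition hab hG t ht i).unique
    (hasSum_birthDeathGen_indicator_mul (birthDeathTransition a b t i) j)

/-- Kolmogorov's forward equation. -/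
theorem transition_hasDerivWithinAt (hab : ConfiningRates a b) (t : ℝ) (ht : 0 ≤ t) (i j : ℤ) :
    HasDerivWithinAt (fun r => birthDeathTransition a b r i j)
      (birthDeathFwd a b (birthDeathTransition a b t i) j) (Set.Ici 0) t := by
  rw [← birthDeathGen_transition_eq_fwd hab t ht i j]
  exact semigroup_hasDerivWithinAt hab (abs_indicator_le j) t ht i

/-- Contractivity of the semigroup makes the bound uniform in both time and starting site, as needed
to differentiate the law term by term. -/
theorem exists_abs_fwd_transition_le (hab : ConfiningRates a b) (j : ℤ) :
    ∃ G, ∀ t, 0 ≤ t → ∀ i, |birthDeathFwd a b (birthDeathTransition a b t i) j| ≤ G := by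
  obtain ⟨G, hG⟩ := exists_abs_birthDeathGen_indicator_le hab j
  refine ⟨G, fun t ht i => ?_⟩
  rw [← birthDeathGen_transition_eq_fwd hab t ht i j,
    birthDeathGen_transition_eq_semigroup hab t ht i j]
  exact abs_semigroup_le hab hG t ht i

end

/-! ### Forward solutions with conserved mass are laws -/

/-- Nonnegative summable solutions of the forward equation with conserved mass. -/
structure IsForwardSol (a b : ℤ → ℝ) (ρ : ℝ → ℤ → ℝ) : Prop where
  nonneg : ∀ t, 0 ≤ t → ∀ j, 0 ≤ ρ t j
  summable : ∀ t, 0 ≤ t → Summable (ρ t)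
  mass : ∀ t, 0 ≤ t → ∑' j, ρ t j = ∑' j, ρ 0 j
  hasDeriv : ∀ t, 0 ≤ t → ∀ j,
    HasDerivWithinAt (fun r => ρ r j) (birthDeathFwd a b (ρ t) j) (Set.Ici 0) t

/-- The law at time `t` of the birth-death process with initial law `r`. -/
noncomputable def birthDeathLaw (a b : ℤ → ℝ) (r : ℤ → ℝ) (t : ℝ) (j : ℤ) : ℝ :=
  ∑' i, r i * birthDeathTransition a b t i j

section
variable {a b : ℤ → ℝ}

theorem summable_mul_transition (hab : ConfiningRates a b) {r : ℤ → ℝ} (hr : ∀ i, 0 ≤ r i)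
    (hs : Summable r) (t : ℝ) (ht : 0 ≤ t) (j : ℤ) :
    Summable fun i => r i * birthDeathTransition a b t i j :=
  Summable.of_nonneg_of_le (fun i => mul_nonneg (hr i) (transition_nonneg hab t ht i j))
    (fun i => mul_le_of_le_one_right (hr i) (transition_le_one hab t ht i j)) hs

theorem hasSum_law (hab : ConfiningRates a b) {r : ℤ → ℝ} (hr : ∀ i, 0 ≤ r i)
    (hs : Summable r) (t : ℝ) (ht : 0 ≤ t) : HasSum (birthDeathLaw a b r t) (∑' i, r i) := by
  have h1 : ∀ i, HasSum (fun j => r i * birthDeathTransition a b t i j) (r i) := fun i => by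
    simpa using (hasSum_transition hab t ht i).mul_left (r i)
  have h2 : Summable fun p : ℤ × ℤ => r p.1 * birthDeathTransition a b t p.1 p.2 := by
    refine (summable_prod_of_nonneg fun p => ?_).2 ⟨fun i => (h1 i).summable, ?_⟩
    · exact mul_nonneg (hr p.1) (transition_nonneg hab t ht p.1 p.2)
    · simpa only [(h1 _).tsum_eq] using hs
  have h3 := h2.hasSum
  rw [h2.tsum_prod' fun i => (h1 i).summable] at h3
  simp only [(h1 _).tsum_eq] at h3
  have h4 : HasSum (fun p : ℤ × ℤ => r p.2 * birthDeathTransition a b t p.2 p.1) (∑' i, r i) :=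
    (Equiv.prodComm ℤ ℤ).hasSum_iff.2 h3
  exact h4.prod_fiberwise fun j => (summable_mul_transition hab hr hs t ht j).hasSum

theorem birthDeathFwd_law (hab : ConfiningRates a b) {r : ℤ → ℝ} (hr : ∀ i, 0 ≤ r i)
    (hs : Summable r) (t : ℝ) (ht : 0 ≤ t) (j : ℤ) :
    birthDeathFwd a b (birthDeathLaw a b r t) j
      = ∑' i, r i * birthDeathFwd a b (birthDeathTransition a b t i) j := by
  have h := fun j => (summable_mul_transition hab hr hs t ht j).hasSum
  have := (((h (j - 1)).mul_left (a (j - 1))).add ((h (j + 1)).mul_left (b (j + 1)))).sub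
    ((h j).mul_left (a j + b j))
  rw [birthDeathFwd, birthDeathLaw, birthDeathLaw, birthDeathLaw, ← this.tsum_eq]
  refine tsum_congr fun i => ?_
  simp only [birthDeathFwd]
  ring

theorem law_hasDerivWithinAt (hab : ConfiningRates a b) {r : ℤ → ℝ} (hr : ∀ i, 0 ≤ r i)
    (hs : Summable r) (t : ℝ) (ht : 0 ≤ t) (j : ℤ) :
    HasDerivWithinAt (fun s => birthDeathLaw a b r s j)
      (birthDeathFwd a b (birthDeathLaw a b r t) j) (Set.Ici 0) t := by
  obtain ⟨G, hG⟩ := exists_abs_fwd_transition_le hab j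
  rw [birthDeathFwd_law hab hr hs t ht j]
  refine hasDerivWithinAt_Ici_of_tendstoUniformlyOn (l := atTop)
    (F := fun (S : Finset ℤ) s => ∑ i ∈ S, r i * birthDeathTransition a b s i j)
    (F' := fun (S : Finset ℤ) s => ∑ i ∈ S, r i * birthDeathFwd a b (birthDeathTransition a b s i) j)
    (G' := fun s => ∑' i, r i * birthDeathFwd a b (birthDeathTransition a b s i) j)
    ?_ ?_ ?_ t ht
  · intro S s hs'
    exact HasDerivWithinAt.fun_sum fun i _ =>
      (transition_hasDerivWithinAt hab s hs' i j).const_mul (r i)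
  · intro s hs'
    exact (summable_mul_transition hab hr hs s hs' j).hasSum
  · intro T _
    refine tendstoUniformlyOn_tsum (hs.mul_right G) fun i s hs' => ?_
    rw [Real.norm_eq_abs, abs_mul, abs_of_nonneg (hr i)]
    exact mul_le_mul_of_nonneg_left (hG s hs'.1 i) (hr i)

theorem law_zero (hab : ConfiningRates a b) (r : ℤ → ℝ) : birthDeathLaw a b r 0 = r := by
  funext j
  simp [birthDeathLaw, transition_zero hab]

theorem law_isForwardSol (hab : ConfiningRates a b) {r : ℤ → ℝ} (hr : ∀ i, 0 ≤ r i)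
    (hs : Summable r) : IsForwardSol a b (birthDeathLaw a b r) where
  nonneg t ht j := tsum_nonneg fun i => mul_nonneg (hr i) (transition_nonneg hab t ht i j)
  summable t ht := (hasSum_law hab hr hs t ht).summable
  mass t ht := by
    rw [(hasSum_law hab hr hs t ht).tsum_eq, (hasSum_law hab hr hs 0 le_rfl).tsum_eq]
  hasDeriv t ht j := law_hasDerivWithinAt hab hr hs t ht j

theorem sum_Icc_neg_succ (X : ℤ → ℝ) (N : ℕ) :
    ∑ i ∈ Finset.Icc (-((N + 1 : ℕ) : ℤ)) ((N + 1 : ℕ) : ℤ), X i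
      = X (-((N : ℤ) + 1)) + X ((N : ℤ) + 1) + ∑ i ∈ Finset.Icc (-(N : ℤ)) N, X i := by
  have : Finset.Icc (-((N + 1 : ℕ) : ℤ)) ((N + 1 : ℕ) : ℤ)
      = insert (-((N : ℤ) + 1)) (insert ((N : ℤ) + 1) (Finset.Icc (-(N : ℤ)) N)) := by
    ext k
    simp only [Finset.mem_Icc, Finset.mem_insert]
    push_cast
    omega
  rw [this, Finset.sum_insert, Finset.sum_insert]
  · ring
  · simp
  · simp only [Finset.mem_insert, Finset.mem_Icc]
    omega

theorem sum_Icc_neg_sub_add_one (X : ℤ → ℝ) (N : ℕ) :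
    ∑ i ∈ Finset.Icc (-(N : ℤ)) N, (X i - X (i + 1)) = X (-(N : ℤ)) - X ((N : ℤ) + 1) := by
  induction N with
  | zero => simp
  | succ N ih =>
    rw [sum_Icc_neg_succ, ih]
    push_cast
    rw [show -((N : ℤ) + 1) + 1 = -(N : ℤ) by ring]
    ring

/-- Discrete Green formula on `[-N, N]`: only the inflow through the boundary remains. -/
theorem sum_fwd_mul_sub_mul_gen (p v : ℤ → ℝ) (N : ℕ) (hv : ∀ i : ℤ, (N : ℤ) < |i| → v i = 0) :
    ∑ i ∈ Finset.Icc (-(N : ℤ)) N, (birthDeathFwd a b p i * v i - p i * birthDeathGen a b v i)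
      = a (-(N : ℤ) - 1) * p (-(N : ℤ) - 1) * v (-(N : ℤ))
        + b ((N : ℤ) + 1) * p ((N : ℤ) + 1) * v N := by
  have h1 := sum_Icc_neg_sub_add_one (fun i => a (i - 1) * p (i - 1) * v i) N
  have h2 := sum_Icc_neg_sub_add_one (fun i => b i * p i * v (i - 1)) N
  have e1 : v ((N : ℤ) + 1) = 0 := hv _ (by rw [Int.abs_eq_natAbs]; omega)
  have e2 : v (-(N : ℤ) - 1) = 0 := hv _ (by rw [Int.abs_eq_natAbs]; omega)
  simp only [add_sub_cancel_right, e1, e2, mul_zero, sub_zero, zero_sub] at h1 h2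
  rw [← h1, ← neg_eq_iff_eq_neg.2 h2, ← sub_eq_add_neg, ← Finset.sum_sub_distrib]
  refine Finset.sum_congr rfl fun i _ => ?_
  simp only [birthDeathFwd, birthDeathGen]
  ring

/-- Forward solutions dominate the killed process. -/
theorem IsForwardSol.sum_killedSol_le (hab : ConfiningRates a b) {ρ : ℝ → ℤ → ℝ}
    (hρ : IsForwardSol a b ρ) {N : ℕ} {j : ℤ} (hj : |j| ≤ N) (T : ℝ) (hT : 0 ≤ T) :
    ∑ i ∈ Finset.Icc (-(N : ℤ)) N,
      ρ 0 i * killedSol a b N (fun k => if k = j then 1 else 0) T i ≤ ρ T j := by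
  set f : ℤ → ℝ := fun k => if k = j then 1 else 0 with hf
  -- Duality: `φ` runs from the pairing of the initial data with the killed solution at time `T` to
  -- `ρ T j`, and it increases because only the inflow through the boundary contributes to its
  -- derivative.
  set φ : ℝ → ℝ := fun t => ∑ i ∈ Finset.Icc (-(N : ℤ)) N, ρ t i * killedSol a b N f (T - t) i
    with hφ
  have hf0 : ∀ i, 0 ≤ f i := fun i => by simp only [hf]; split_ifs <;> simp
  have hder : ∀ t, 0 ≤ t → HasDerivWithinAt φ
      (∑ i ∈ Finset.Icc (-(N : ℤ)) N, (birthDeathFwd a b (ρ t) i * killedSol a b N f (T - t) i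
        - ρ t i * birthDeathGen a b (killedSol a b N f (T - t)) i)) (Set.Ici 0) t := by
    intro t ht
    refine HasDerivWithinAt.fun_sum fun i hi => ?_
    have h1 := (killedSol_hasDerivAt (a := a) (b := b) N f (T - t)
      (abs_le_of_mem_Icc hi)).comp_const_sub T t
    have h2 := (hρ.hasDeriv t ht i).fun_mul h1.hasDerivWithinAt
    refine h2.congr_deriv ?_
    ring
  have hmono : MonotoneOn φ (Set.Icc 0 T) := by
    refine monotoneOn_of_deriv_nonneg (convex_Icc 0 T)
      (fun t ht => ((hder t ht.1).mono Set.Icc_subset_Ici_self).continuousWithinAt)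
      (fun t ht => ?_) fun t ht => ?_ <;> rw [interior_Icc] at ht <;>
      have h := (hder t ht.1.le).hasDerivAt (Ici_mem_nhds ht.1)
    · exact h.differentiableAt.differentiableWithinAt
    · rw [h.deriv, sum_fwd_mul_sub_mul_gen _ _ N fun i hi => killedSol_of_lt N f _ hi]
      have hk := fun i => killedSol_nonneg hab N hf0 (T - t) (by linarith [ht.2]) i
      have hp := hρ.nonneg t ht.1.le
      have ha := (hab.right_pos (-(N : ℤ) - 1)).le
      have hb := (hab.left_pos ((N : ℤ) + 1)).le
      exact add_nonneg (mul_nonneg (mul_nonneg ha (hp _)) (hk _))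
        (mul_nonneg (mul_nonneg hb (hp _)) (hk _))
  have h0T := hmono ⟨le_rfl, hT⟩ ⟨hT, le_rfl⟩ hT
  have hφT : φ T = ρ T j := by
    have : ∀ i ∈ Finset.Icc (-(N : ℤ)) N,
        ρ T i * killedSol a b N f (T - T) i = if i = j then ρ T i else 0 := fun i hi => by
      rw [sub_self, killedSol_zero N f (abs_le_of_mem_Icc hi)]
      simp [hf]
    simp only [hφ]
    rw [Finset.sum_congr rfl this, Finset.sum_ite_eq', if_pos (Finset.mem_Icc.2 (abs_le.1 hj))]
  rw [hφT] at h0T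
  simpa [hφ] using h0T

/-- A forward solution is the law of the birth-death process. -/
theorem IsForwardSol.eq_law (hab : ConfiningRates a b) {ρ : ℝ → ℤ → ℝ}
    (hρ : IsForwardSol a b ρ) (t : ℝ) (ht : 0 ≤ t) (j : ℤ) :
    ρ t j = birthDeathLaw a b (ρ 0) t j := by
  have hr := hρ.nonneg 0 le_rfl
  have hs := hρ.summable 0 le_rfl
  have hle : ∀ j, birthDeathLaw a b (ρ 0) t j ≤ ρ t j := by
    intro j
    refine (summable_mul_transition hab hr hs t ht j).tsum_le_of_sum_le fun S => ?_
    have hlim : Tendsto (fun N => ∑ i ∈ S,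
        ρ 0 i * killedSol a b N (fun k => if k = j then 1 else 0) t i) atTop
        (𝓝 (∑ i ∈ S, ρ 0 i * birthDeathTransition a b t i j)) :=
      tendsto_finsetSum _ fun i _ =>
        (tendsto_killedSol hab (abs_indicator_le j) t ht i).const_mul _
    refine le_of_tendsto hlim ?_
    have hS : ∀ᶠ N : ℕ in atTop, ∀ i ∈ S, i ∈ Finset.Icc (-(N : ℤ)) N := by
      refine (Filter.eventually_all_finset S).2 fun i _ => ?_
      filter_upwards [eventually_ge_atTop i.natAbs] with N hN
      rw [Finset.mem_Icc]; omega
    filter_upwards [hS, eventually_ge_atTop j.natAbs] with N hN hj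
    refine le_trans (Finset.sum_le_sum_of_subset_of_nonneg hN fun i _ _ => ?_)
      (hρ.sum_killedSol_le hab (by rw [Int.abs_eq_natAbs]; omega) t ht)
    exact mul_nonneg (hr i) (killedSol_nonneg hab N (fun k => by split_ifs <;> simp) t ht i)
  -- The nonnegative differences sum to zero, since both sides carry the initial mass.
  have hsum : HasSum (fun j => ρ t j - birthDeathLaw a b (ρ 0) t j) 0 := by
    have := (hρ.summable t ht).hasSum.sub (hasSum_law hab hr hs t ht)
    rwa [hρ.mass t ht, sub_self] at this
  have := congrFun ((hasSum_zero_iff_of_nonneg fun j => sub_nonneg.2 (hle j)).1 hsum) j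
  simpa [sub_eq_zero] using this

end

/-! ### Stationary distributions and detailed balance -/

section
variable {a b : ℤ → ℝ}

/-- A summable nonnegative stationary sequence has zero flux (detailed balance). -/
theorem detailed_balance_of_fwd_eq_zero (hab : ConfiningRates a b) {π : ℤ → ℝ}
    (h0 : ∀ j, 0 ≤ π j) (hs : Summable π) (hπ : ∀ j, birthDeathFwd a b π j = 0) (j : ℤ) :
    a j * π j = b (j + 1) * π (j + 1) := by
  obtain ⟨A, hA, hB⟩ := hab.bounded
  have hstep : ∀ k, a k * π k - b (k + 1) * π (k + 1)
      = a (k - 1) * π (k - 1) - b k * π k := fun k => by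
    have := hπ k
    simp only [birthDeathFwd] at this
    linarith
  have hconst : ∀ k, a k * π k - b (k + 1) * π (k + 1) = a 0 * π 0 - b (0 + 1) * π (0 + 1) := by
    intro k
    induction k using Int.induction_on with
    | zero => rfl
    | succ n ih =>
      rw [hstep, ← ih]; simp
    | pred n ih =>
      rw [← ih, hstep (-(n : ℤ))]; simp
  set J := a 0 * π 0 - b (0 + 1) * π (0 + 1) with hJ
  have hlim := hs.tendsto_cofinite_zero
  rw [Int.cofinite_eq, tendsto_sup] at hlim
  -- To the right `J ≤ a k * π k ≤ A * π k → 0`; to the left, in the same way, `-J ≤ b k * π k ≤ A *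
  -- π k → 0`.
  have hle : J ≤ 0 := by
    have : Tendsto (fun k => A * π k) atTop (𝓝 0) := by simpa using hlim.2.const_mul A
    refine ge_of_tendsto this ?_
    filter_upwards [eventually_ge_atTop 0] with k hk
    have h1 := mul_le_mul_of_nonneg_right (hA k hk) (h0 k)
    have h2 := mul_nonneg (hab.left_pos (k + 1)).le (h0 (k + 1))
    linarith [hconst k]
  have hge : 0 ≤ J := by
    have h : Tendsto (fun k => -(A * π k)) atBot (𝓝 0) := by simpa using (hlim.1.const_mul A).neg
    refine le_of_tendsto h ?_
    filter_upwards [eventually_le_atBot 0] with k hk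
    have h1 := mul_le_mul_of_nonneg_right (hB k hk) (h0 k)
    have h2 := mul_nonneg (hab.right_pos (k - 1)).le (h0 (k - 1))
    linarith [hconst k, hstep k]
  linarith [hconst j]

theorem fwd_eq_zero_of_detailed_balance {π : ℤ → ℝ}
    (h : ∀ j, a j * π j = b (j + 1) * π (j + 1)) (j : ℤ) : birthDeathFwd a b π j = 0 := by
  have h1 := h (j - 1)
  have h2 := h j
  rw [sub_add_cancel] at h1
  simp only [birthDeathFwd]
  linarith

/-- Detailed balance is a first-order recursion with nonzero coefficients, so two solutions are
proportional; the cross-multiplied form avoids division by possible zeros. -/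
theorem mul_eq_mul_of_detailed_balance (hab : ConfiningRates a b) {π π' : ℤ → ℝ}
    (h : ∀ j, a j * π j = b (j + 1) * π (j + 1)) (h' : ∀ j, a j * π' j = b (j + 1) * π' (j + 1))
    (i j : ℤ) : π j * π' i = π' j * π i := by
  induction j using Int.inductionOn' (b := i) with
  | zero => ring
  | succ k _ ih =>
    refine mul_left_cancel₀ (hab.left_pos (k + 1)).ne' ?_
    rw [← mul_assoc, ← mul_assoc, ← h, ← h', mul_assoc, ih, mul_assoc]
  | pred k _ ih =>
    refine mul_left_cancel₀ (hab.right_pos (k - 1)).ne' ?_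
    rw [← mul_assoc, ← mul_assoc, h, h', sub_add_cancel, mul_assoc, ih, mul_assoc]

theorem eq_of_detailed_balance (hab : ConfiningRates a b) {π π' : ℤ → ℝ}
    (h : ∀ j, a j * π j = b (j + 1) * π (j + 1)) (h' : ∀ j, a j * π' j = b (j + 1) * π' (j + 1))
    (hs : HasSum π 1) (hs' : HasSum π' 1) : π = π' := by
  funext j
  have h1 := hs'.mul_left (π j)
  have h2 := hs.mul_left (π' j)
  simp only [mul_eq_mul_of_detailed_balance hab h h'] at h1
  simpa using h1.unique h2

/-- Existence of a positive reversible probability distribution. -/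
theorem exists_detailed_balance (hab : ConfiningRates a b) :
    ∃ π : ℤ → ℝ, (∀ j, 0 < π j) ∧ HasSum π 1 ∧ ∀ j, a j * π j = b (j + 1) * π (j + 1) := by
  obtain ⟨A, hA, hB⟩ := hab.bounded
  set r : ℕ → ℝ := fun k => a k / b (k + 1) with hr
  set l : ℕ → ℝ := fun k => b (-(k : ℤ)) / a (-(k : ℤ) - 1) with hl
  have hr0 : ∀ k, 0 < r k := fun k => div_pos (hab.right_pos _) (hab.left_pos _)
  have hl0 : ∀ k, 0 < l k := fun k => div_pos (hab.left_pos _) (hab.right_pos _)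
  -- Since `toNat` sends negative integers to `0`, at most one of the two products is nonempty.
  set m : ℤ → ℝ := fun j => (∏ k ∈ Finset.range j.toNat, r k) *
    ∏ k ∈ Finset.range (-j).toNat, l k with hm
  have hm0 : ∀ j, 0 < m j := fun j =>
    mul_pos (Finset.prod_pos fun k _ => hr0 k) (Finset.prod_pos fun k _ => hl0 k)
  have hbal : ∀ j, a j * m j = b (j + 1) * m (j + 1) := by
    intro j
    rcases le_or_gt 0 j with hj | hj
    · lift j to ℕ using hj
      have e1 : (-(j : ℤ)).toNat = 0 := by omega
      have e2 : (-((j : ℤ) + 1)).toNat = 0 := by omega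
      have e3 : ((j : ℤ) + 1).toNat = j + 1 := by omega
      have hne := (hab.left_pos ((j : ℤ) + 1)).ne'
      simp only [hm, e1, e2, e3, Int.toNat_natCast, Finset.prod_range_succ, Finset.prod_range_zero,
        hr]
      field_simp
    · obtain ⟨n, rfl⟩ : ∃ n : ℕ, j = -(n : ℤ) - 1 := ⟨(-j - 1).toNat, by omega⟩
      have e1 : (-(n : ℤ) - 1).toNat = 0 := by omega
      have e2 : (-(n : ℤ)).toNat = 0 := by omega
      have e3 : (-(-(n : ℤ) - 1)).toNat = n + 1 := by omega
      have e4 : (-(-(n : ℤ))).toNat = n := by omega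
      have hne := (hab.right_pos (-(n : ℤ) - 1)).ne'
      simp only [hm, sub_add_cancel, e1, e2, e3, e4, Finset.prod_range_succ,
        Finset.prod_range_zero, hl]
      field_simp
  have hcast : Tendsto (fun n : ℕ => (n : ℤ)) atTop atTop := tendsto_natCast_atTop_atTop
  have hsum : Summable m := by
    refine Summable.of_nat_of_neg ?_ ?_
    · refine summable_of_ratio_test_tendsto_lt_one (l := 0) one_pos
        (Eventually.of_forall fun n => (hm0 n).ne') ?_
      have hb : Tendsto (fun n : ℕ => A / b ((n : ℤ) + 1)) atTop (𝓝 0) :=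
        ((hab.left_tendsto.comp (tendsto_atTop_add_const_right _ 1 hcast)).const_div_atTop A)
      refine squeeze_zero (fun n => by positivity) (fun n => ?_) hb
      have h1 := hbal n
      have hp := hab.left_pos ((n : ℤ) + 1)
      rw [Real.norm_of_nonneg (hm0 _).le, Real.norm_of_nonneg (hm0 _).le,
        div_le_div_iff₀ (hm0 _) hp]
      push_cast
      have := mul_le_mul_of_nonneg_right (hA n (by omega)) (hm0 n).le
      linarith
    · refine summable_of_ratio_test_tendsto_lt_one (l := 0) one_pos
        (Eventually.of_forall fun n => (hm0 _).ne') ?_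
      have hneg : Tendsto (fun n : ℕ => -(n : ℤ) - 1) atTop atBot :=
        tendsto_atBot_add_const_right _ _ (tendsto_neg_atTop_atBot.comp hcast)
      have hb : Tendsto (fun n : ℕ => A / a (-(n : ℤ) - 1)) atTop (𝓝 0) :=
        (hab.right_tendsto.comp hneg).const_div_atTop A
      refine squeeze_zero (fun n => by positivity) (fun n => ?_) hb
      have h1 := hbal (-(n : ℤ) - 1)
      rw [sub_add_cancel] at h1
      have hp := hab.right_pos (-(n : ℤ) - 1)
      rw [Real.norm_of_nonneg (hm0 _).le, Real.norm_of_nonneg (hm0 _).le,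
        div_le_div_iff₀ (hm0 _) hp, show -((n + 1 : ℕ) : ℤ) = -(n : ℤ) - 1 by push_cast; ring]
      have := mul_le_mul_of_nonneg_right (hB (-(n : ℤ)) (by omega)) (hm0 (-(n : ℤ))).le
      linarith
  have hM : 0 < ∑' j, m j := hsum.tsum_pos (fun j => (hm0 j).le) 0 (hm0 0)
  refine ⟨fun j => m j / ∑' j, m j, fun j => div_pos (hm0 j) hM, ?_, fun j => ?_⟩
  · simpa [hM.ne'] using hsum.hasSum.div_const (∑' j, m j)
  · rw [mul_div_assoc', hbal, mul_div_assoc]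

/-- The conductances of a reversible distribution are summable. -/
theorem summable_conductance (hab : ConfiningRates a b) {π : ℤ → ℝ} (h0 : ∀ j, 0 ≤ π j)
    (hs : Summable π) (h : ∀ j, a j * π j = b (j + 1) * π (j + 1)) :
    Summable fun j => a j * π j := by
  obtain ⟨A, hA, hB⟩ := hab.bounded
  have hA0 : 0 ≤ A := (hab.right_pos 0).le.trans (hA 0 le_rfl)
  have hs' : Summable fun j => π (j + 1) := (Equiv.addRight (1 : ℤ)).summable_iff.2 hs
  refine Summable.of_nonneg_of_le (fun j => mul_nonneg (hab.right_pos j).le (h0 j)) (fun j => ?_)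
    ((hs.add hs').mul_left A)
  have h1 := mul_nonneg hA0 (h0 j)
  have h2 := mul_nonneg hA0 (h0 (j + 1))
  rcases le_or_gt 0 j with hj | hj
  · have := mul_le_mul_of_nonneg_right (hA j hj) (h0 j)
    linarith
  · rw [h]
    have := mul_le_mul_of_nonneg_right (hB (j + 1) hj) (h0 (j + 1))
    linarith

end

/-! ### Energy dissipation and convergence to equilibrium -/

/-- A Barbalat-type lemma: a Lipschitz function that is dissipated by a nonnegative energy tends
to zero. -/
theorem tendsto_zero_of_hasDerivWithinAt_le {E E' ψ : ℝ → ℝ} {c L : ℝ} (hc : 0 < c)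
    (hE0 : ∀ t, 0 ≤ t → 0 ≤ E t)
    (hE : ∀ t, 0 ≤ t → HasDerivWithinAt E (E' t) (Set.Ici 0) t)
    (hE' : ∀ t, 0 ≤ t → E' t ≤ -(c * ψ t ^ 2))
    (hψ : ∀ s t, 0 ≤ s → 0 ≤ t → |ψ t - ψ s| ≤ L * |t - s|) : Tendsto ψ atTop (𝓝 0) := by
  have hL : 0 ≤ L := by simpa using (abs_nonneg _).trans (hψ 0 1 le_rfl zero_le_one)
  have hanti : AntitoneOn E (Set.Ici 0) := by
    refine antitoneOn_of_deriv_nonpos (convex_Ici 0) (fun t ht => (hE t ht).continuousWithinAt)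
      (fun t ht => ?_) fun t ht => ?_ <;> rw [interior_Ici] at ht <;>
      have h := (hE t (le_of_lt ht)).hasDerivAt (Ici_mem_nhds ht)
    · exact h.differentiableAt.differentiableWithinAt
    · rw [h.deriv]
      have := hE' t (le_of_lt ht)
      have : 0 ≤ c * ψ t ^ 2 := by positivity
      linarith
  obtain ⟨e, he⟩ : ∃ e, Tendsto E atTop (𝓝 e) := by
    have h1 : Antitone fun t => E (max t 0) := fun s t hst =>
      hanti (Set.mem_Ici.2 (le_max_right s 0)) (Set.mem_Ici.2 (le_max_right t 0)) (max_le_max_right 0 hst)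
    have h2 : BddBelow (Set.range fun t => E (max t 0)) :=
      ⟨0, by rintro _ ⟨t, rfl⟩; exact hE0 _ (le_max_right _ _)⟩
    refine ⟨_, (tendsto_atTop_ciInf h1 h2).congr' ?_⟩
    filter_upwards [eventually_ge_atTop 0] with t ht
    rw [max_eq_left ht]
  rw [Metric.tendsto_atTop]
  intro ε hε
  -- On an interval of length `δ` the function `ψ` varies by at most `L * δ ≤ ε / 2`.
  set δ : ℝ := ε / (2 * (L + 1)) with hδ
  have hδ0 : 0 < δ := by positivity
  have hdiff : Tendsto (fun t => E t - E (t + δ)) atTop (𝓝 0) := by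
    simpa using he.sub (he.comp (tendsto_atTop_add_const_right _ δ tendsto_id))
  -- This is the energy lost over time `δ` if `|ψ| ≥ ε / 2` throughout. At late times less is lost,
  -- so some `ξ` in the interval has `|ψ ξ| < ε / 2`.
  have hpos : 0 < c * (ε / 2) ^ 2 * δ := by positivity
  obtain ⟨T, hT⟩ := eventually_atTop.1
    ((hdiff.eventually (gt_mem_nhds hpos)).and (eventually_ge_atTop 0))
  refine ⟨T, fun t ht => ?_⟩
  obtain ⟨hsmall, ht0⟩ := hT t ht
  obtain ⟨ξ, ⟨hξ1, hξ2⟩, hξ⟩ := exists_hasDerivAt_eq_slope E E' (by linarith : t < t + δ)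
    (fun s hs => ((hE s (ht0.trans hs.1)).mono
      fun r hr => ht0.trans hr.1).continuousWithinAt)
    (fun s hs => (hE s (ht0.trans hs.1.le)).hasDerivAt (Ici_mem_nhds (ht0.trans_lt hs.1)))
  have h1 := hE' ξ (by linarith)
  rw [hξ, add_sub_cancel_left, div_le_iff₀ hδ0] at h1
  have h2 : ψ ξ ^ 2 < (ε / 2) ^ 2 := by
    have : (c * δ) * ψ ξ ^ 2 < (c * δ) * (ε / 2) ^ 2 := by linarith
    exact lt_of_mul_lt_mul_left this (by positivity)
  have h3 : |ψ ξ| < ε / 2 := abs_lt_of_sq_lt_sq h2 (by positivity)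
  have h4 := hψ ξ t (by linarith) ht0
  have h5 : |t - ξ| ≤ δ := by rw [abs_le]; constructor <;> linarith
  have h6 : L * |t - ξ| ≤ ε / 2 := by
    have : (L + 1) * δ = ε / 2 := by rw [hδ]; field_simp
    nlinarith [mul_le_mul_of_nonneg_left h5 hL]
  rw [Real.dist_eq, sub_zero]
  have h7 : |ψ t| ≤ |ψ ξ| + |ψ t - ψ ξ| := by
    have := abs_add_le (ψ ξ) (ψ t - ψ ξ)
    simpa using this
  linarith

section
variable {a b : ℤ → ℝ}

/-- The generator of a bounded function grows like the unbounded total rate; this is the majorant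
for differentiating the energy term by term. -/
theorem summable_rate_mul (hab : ConfiningRates a b) {π : ℤ → ℝ} (h0 : ∀ j, 0 ≤ π j)
    (hs : Summable π) (h : ∀ j, a j * π j = b (j + 1) * π (j + 1)) :
    Summable fun j => (a j + b j) * π j := by
  have hg := summable_conductance hab h0 hs h
  have hg' : Summable fun j => b j * π j := by
    refine (Equiv.addRight (1 : ℤ)).summable_iff.1 (hg.congr fun j => ?_)
    simpa using h j
  simpa only [add_mul] using hg.add hg'

/-- The Dirichlet form dominates every single squared difference. -/
theorem tsum_mul_birthDeathGen_le (hab : ConfiningRates a b) {π : ℤ → ℝ} (h0 : ∀ j, 0 ≤ π j)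
    (hs : Summable π) (h : ∀ j, a j * π j = b (j + 1) * π (j + 1)) {v : ℤ → ℝ} {B : ℝ}
    (hv : ∀ i, |v i| ≤ B) (i : ℤ) :
    ∑' k, π k * (2 * (v k * birthDeathGen a b v k))
      ≤ -(2 * (a i * π i) * (v (i + 1) - v i) ^ 2) := by
  have hB : 0 ≤ B := (abs_nonneg _).trans (hv 0)
  have hg := summable_conductance hab h0 hs h
  have hg0 : ∀ j, 0 ≤ a j * π j := fun j => mul_nonneg (hab.right_pos j).le (h0 j)
  have hd : ∀ k, |v (k + 1) - v k| ≤ 2 * B := fun k =>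
    (abs_sub _ _).trans (by linarith [hv (k + 1), hv k])
  have hsum : ∀ w : ℤ → ℝ, (∀ k, |w k| ≤ B) →
      Summable fun k => a k * π k * (w k * (v (k + 1) - v k)) := by
    intro w hw
    refine Summable.of_norm_bounded (hg.mul_right (B * (2 * B))) fun k => ?_
    rw [Real.norm_eq_abs, abs_mul, abs_of_nonneg (hg0 k), abs_mul]
    exact mul_le_mul_of_nonneg_left (mul_le_mul (hw k) (hd k) (abs_nonneg _) hB) (hg0 k)
  have h1 := (hsum v hv).hasSum
  have h2 := (hsum (fun k => v (k + 1)) fun k => hv (k + 1)).hasSum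
  have h3 : HasSum (fun k => a (k - 1) * π (k - 1) * (v k * (v k - v (k - 1))))
      (∑' k, a k * π k * (v (k + 1) * (v (k + 1) - v k))) := by
    refine (Equiv.addRight (1 : ℤ)).hasSum_iff.1 ?_
    simpa [Function.comp_def] using h2
  have h4 := (h1.sub h3).mul_left 2
  have e4 : ∀ k, 2 * (a k * π k * (v k * (v (k + 1) - v k))
      - a (k - 1) * π (k - 1) * (v k * (v k - v (k - 1))))
      -- Detailed balance turns the shifted conductance `a (k - 1) * π (k - 1)` into `b k * π k`:
      -- this is summation by parts.
      = π k * (2 * (v k * birthDeathGen a b v k)) := by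
    intro k
    have := h (k - 1)
    rw [sub_add_cancel] at this
    rw [this, birthDeathGen]
    ring
  simp only [e4] at h4
  have h5 := h2.sub h1
  have e5 : ∀ k, a k * π k * (v (k + 1) * (v (k + 1) - v k))
      - a k * π k * (v k * (v (k + 1) - v k)) = a k * π k * (v (k + 1) - v k) ^ 2 := fun k => by ring
  simp only [e5] at h5
  have h6 := le_hasSum h5 i fun k _ => mul_nonneg (hg0 k) (sq_nonneg _)
  rw [h4.tsum_eq]
  linarith

/-- Along bounded backward solutions, differences of neighbouring values vanish in the limit. -/
theorem tendsto_semigroup_sub (hab : ConfiningRates a b) {π : ℤ → ℝ} (h0 : ∀ j, 0 < π j)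
    (hs : Summable π) (h : ∀ j, a j * π j = b (j + 1) * π (j + 1)) {f : ℤ → ℝ} {B : ℝ}
    (hf : ∀ i, |f i| ≤ B) (i : ℤ) :
    Tendsto (fun t => birthDeathSemigroup a b f t (i + 1) - birthDeathSemigroup a b f t i) atTop
      (𝓝 0) := by
  have hB : 0 ≤ B := (abs_nonneg _).trans (hf 0)
  have hπ0 : ∀ j, 0 ≤ π j := fun j => (h0 j).le
  set u := birthDeathSemigroup a b f with hu
  have hub : ∀ t, 0 ≤ t → ∀ i, |u t i| ≤ B := abs_semigroup_le hab hf
  have hgen : ∀ t, 0 ≤ t → ∀ i, |birthDeathGen a b (u t) i| ≤ 2 * (a i + b i) * B :=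
    fun t ht i => abs_birthDeathGen_le hab (hub t ht _) (hub t ht _) (hub t ht _)
  have hder := fun t ht i => semigroup_hasDerivWithinAt hab hf t ht i
  rw [← hu] at hder
  refine tendsto_zero_of_hasDerivWithinAt_le (E := fun t => ∑' k, π k * u t k ^ 2)
    (E' := fun t => ∑' k, π k * (2 * (u t k * birthDeathGen a b (u t) k)))
    (c := 2 * (a i * π i)) (L := 2 * (a (i + 1) + b (i + 1)) * B + 2 * (a i + b i) * B)
    (by have := hab.right_pos i; have := h0 i; positivity) ?_ ?_ ?_ ?_
  · exact fun t _ => tsum_nonneg fun k => mul_nonneg (hπ0 k) (sq_nonneg _)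
  · refine hasDerivWithinAt_Ici_of_tendstoUniformlyOn (l := atTop)
      (F := fun (S : Finset ℤ) t => ∑ k ∈ S, π k * u t k ^ 2)
      (F' := fun (S : Finset ℤ) t => ∑ k ∈ S, π k * (2 * (u t k * birthDeathGen a b (u t) k)))
      ?_ ?_ ?_
    · intro S t ht
      refine HasDerivWithinAt.fun_sum fun k _ => (HasDerivWithinAt.const_mul (π k) ?_)
      refine ((hder t ht k).fun_pow 2).congr_deriv ?_
      ring
    · intro t ht
      refine (Summable.of_norm_bounded (hs.mul_right (B ^ 2)) fun k => ?_).hasSum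
      rw [Real.norm_eq_abs, abs_mul, abs_of_nonneg (hπ0 k), abs_pow]
      exact mul_le_mul_of_nonneg_left (pow_le_pow_left₀ (abs_nonneg _) (hub t ht k) 2) (hπ0 k)
    · intro T _
      refine tendstoUniformlyOn_tsum
        ((summable_rate_mul hab hπ0 hs h).mul_right (2 * (B * (2 * B)))) fun k t ht => ?_
      rw [Real.norm_eq_abs, abs_mul, abs_of_nonneg (hπ0 k), abs_mul, abs_mul, abs_two]
      have := mul_le_mul (hub t ht.1 k) (hgen t ht.1 k) (abs_nonneg _) hB
      have := mul_le_mul_of_nonneg_left this (hπ0 k)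
      linarith
  · exact fun t ht => tsum_mul_birthDeathGen_le hab hπ0 hs h (hub t ht) i
  · intro s t hs ht
    have := (convex_Ici (0 : ℝ)).norm_image_sub_le_of_norm_hasDerivWithin_le
      (f := fun t => u t (i + 1) - u t i)
      (f' := fun t => birthDeathGen a b (u t) (i + 1) - birthDeathGen a b (u t) i)
      (C := 2 * (a (i + 1) + b (i + 1)) * B + 2 * (a i + b i) * B)
      (fun r hr => (hder r hr (i + 1)).fun_sub (hder r hr i))
      (fun r hr => (abs_sub _ _).trans (add_le_add (hgen r hr _) (hgen r hr _))) hs ht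
    simpa only [Real.norm_eq_abs] using this

theorem tendsto_semigroup_sub_semigroup (hab : ConfiningRates a b) {π : ℤ → ℝ}
    (h0 : ∀ j, 0 < π j) (hs : Summable π) (h : ∀ j, a j * π j = b (j + 1) * π (j + 1))
    {f : ℤ → ℝ} {B : ℝ} (hf : ∀ i, |f i| ≤ B) (i k : ℤ) :
    Tendsto (fun t => birthDeathSemigroup a b f t i - birthDeathSemigroup a b f t k) atTop
      (𝓝 0) := by
  induction i using Int.inductionOn' (b := k) with
  | zero => simp
  | succ m _ ih =>
    simpa using (tendsto_semigroup_sub hab h0 hs h hf m).add ih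
  | pred m _ ih =>
    simpa using ih.sub (tendsto_semigroup_sub hab h0 hs h hf (m - 1))

/-- The sequence `π`, constant in time, is a forward solution with conserved mass, and such
solutions are laws. -/
theorem law_eq_of_detailed_balance (hab : ConfiningRates a b) {π : ℤ → ℝ}
    (h0 : ∀ j, 0 ≤ π j) (hs : Summable π) (h : ∀ j, a j * π j = b (j + 1) * π (j + 1))
    (t : ℝ) (ht : 0 ≤ t) (j : ℤ) : birthDeathLaw a b π t j = π j := by
  have : IsForwardSol a b fun _ => π :=
    ⟨fun _ _ => h0, fun _ _ => hs, fun _ _ => rfl, fun t _ j => by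
      rw [fwd_eq_zero_of_detailed_balance h]; exact hasDerivWithinAt_const _ _ _⟩
  exact (this.eq_law hab t ht j).symm

/-- Convergence to equilibrium of the transition probabilities. -/
theorem tendsto_transition (hab : ConfiningRates a b) {π : ℤ → ℝ} (h0 : ∀ j, 0 < π j)
    (hs : HasSum π 1) (h : ∀ j, a j * π j = b (j + 1) * π (j + 1)) (i j : ℤ) :
    Tendsto (fun t => birthDeathTransition a b t i j) atTop (𝓝 (π j)) := by
  have hπ0 : ∀ j, 0 ≤ π j := fun j => (h0 j).le
  -- As `π` is an invariant probability, this sum equals `p_t(i,j) - π_j`.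
  have hlim : Tendsto (fun t => ∑' k, π k *
      (birthDeathTransition a b t i j - birthDeathTransition a b t k j)) atTop
      (𝓝 (∑' k, π k * 0)) := by
    refine tendsto_tsum_of_dominated_convergence (hs.summable.mul_right 2) (fun k => ?_) ?_
    · exact (tendsto_semigroup_sub_semigroup hab h0 hs.summable h (abs_indicator_le j)
        i k).const_mul (π k)
    · filter_upwards [eventually_ge_atTop 0] with t ht k
      rw [Real.norm_eq_abs, abs_mul, abs_of_nonneg (hπ0 k)]
      refine mul_le_mul_of_nonneg_left ((abs_sub _ _).trans ?_) (hπ0 k)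
      linarith [abs_transition_le_one hab t ht i j, abs_transition_le_one hab t ht k j]
  simp only [mul_zero, tsum_zero] at hlim
  have := hlim.add_const (π j)
  rw [zero_add] at this
  refine this.congr' ?_
  filter_upwards [eventually_ge_atTop 0] with t ht
  have h1 := (summable_mul_transition hab hπ0 hs.summable t ht j).hasSum
  have h2 : ∑' k, π k * birthDeathTransition a b t k j = π j :=
    law_eq_of_detailed_balance hab hπ0 hs.summable h t ht j
  rw [h2] at h1
  have h3 := (hs.mul_right (birthDeathTransition a b t i j)).sub h1
  simp only [← mul_sub, one_mul] at h3
  rw [h3.tsum_eq]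
  ring

end

/-! ### Uniqueness of the transition function -/

section
variable {b σ : ℝ → ℝ} {h : ℝ} {P : ℝ → ℤ → ℤ → ℝ}

theorem IsJumpTransitionFunction.le_one (hP : IsJumpTransitionFunction b σ h P) (t : ℝ)
    (ht : 0 ≤ t) (i j : ℤ) : P t i j ≤ 1 :=
  le_hasSum (hP.total t ht i) j fun k _ => hP.nonneg t ht i k

/-- In the Chapman-Kolmogorov equation, the sites outside `S` contribute at most the mass that
leaves `S`. -/
theorem IsJumpTransitionFunction.chapman_kolmogorov_bounds (hP : IsJumpTransitionFunction b σ h P)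
    {s t : ℝ} (hs : 0 ≤ s) (ht : 0 ≤ t) (i j : ℤ) (S : Finset ℤ) :
    0 ≤ P (s + t) i j - ∑ k ∈ S, P s i k * P t k j ∧
      P (s + t) i j - ∑ k ∈ S, P s i k * P t k j ≤ 1 - ∑ k ∈ S, P s i k := by
  have h1 := hP.chapman_kolmogorov s t hs ht i j
  have h2 := (hP.total s hs i).sub h1
  have h3 := sum_le_hasSum S (fun k _ => mul_nonneg (hP.nonneg s hs i k) (hP.nonneg t ht k j)) h1
  have h4 := sum_le_hasSum S (fun k _ => by
    have := mul_le_of_le_one_right (hP.nonneg s hs i k) (hP.le_one t ht k j)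
    linarith) h2
  rw [Finset.sum_sub_distrib] at h4
  exact ⟨by linarith, by linarith⟩

/-- Taking `S = {i}` leaves `P s i i * P t i j` plus an error in `[0, 1 - P s i i]`. The bound does
not depend on `t`, so continuity at time `0` spreads to all times. -/
theorem IsJumpTransitionFunction.abs_add_sub_le (hP : IsJumpTransitionFunction b σ h P)
    {s t : ℝ} (hs : 0 ≤ s) (ht : 0 ≤ t) (i j : ℤ) :
    |P (s + t) i j - P t i j| ≤ 1 - P s i i := by
  obtain ⟨h1, h2⟩ := hP.chapman_kolmogorov_bounds hs ht i j {i}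
  simp only [Finset.sum_singleton] at h1 h2
  have h3 := hP.le_one t ht i j
  have h4 := hP.le_one s hs i i
  have h5 := hP.nonneg t ht i j
  have h6 := hP.nonneg s hs i i
  rw [abs_le]
  constructor <;> nlinarith

theorem IsJumpTransitionFunction.abs_sub_le (hP : IsJumpTransitionFunction b σ h P)
    {s t : ℝ} (hs : 0 ≤ s) (ht : 0 ≤ t) (i j : ℤ) :
    |P s i j - P t i j| ≤ 1 - P |s - t| i i := by
  rcases le_total t s with hst | hst
  · have := hP.abs_add_sub_le (sub_nonneg.2 hst) ht i j
    rwa [sub_add_cancel, ← abs_of_nonneg (sub_nonneg.2 hst)] at this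
  · have := hP.abs_add_sub_le (sub_nonneg.2 hst) hs i j
    rwa [sub_add_cancel, ← abs_of_nonneg (sub_nonneg.2 hst), abs_sub_comm, abs_sub_comm t] at this

theorem IsJumpTransitionFunction.continuousOn (hP : IsJumpTransitionFunction b σ h P) (i j : ℤ) :
    ContinuousOn (fun t => P t i j) (Set.Ici 0) := by
  intro t ht
  have h0 : Tendsto (fun s => 1 - P |s - t| i i) (𝓝[Set.Ici 0] t) (𝓝 0) := by
    have h1 : Tendsto (fun s => P s i i) (𝓝[Set.Ici 0] 0) (𝓝 1) := by
      simpa [ContinuousWithinAt, hP.zero] using (hP.hasDeriv_zero i i).continuousWithinAt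
    have h2 : Tendsto (fun s : ℝ => |s - t|) (𝓝[Set.Ici 0] t) (𝓝[Set.Ici 0] 0) := by
      refine tendsto_nhdsWithin_iff.2 ⟨?_, Eventually.of_forall fun s => Set.mem_Ici.2 (abs_nonneg (s - t))⟩
      have : Continuous fun s : ℝ => |s - t| := by fun_prop
      simpa using (this.tendsto t).mono_left nhdsWithin_le_nhds
    simpa using (h1.comp h2).const_sub 1
  rw [ContinuousWithinAt, tendsto_iff_dist_tendsto_zero]
  refine squeeze_zero' (Eventually.of_forall fun _ => dist_nonneg) ?_ h0
  filter_upwards [self_mem_nhdsWithin] with s hs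
  rw [Real.dist_eq]
  exact hP.abs_sub_le hs ht i j

/-- Kolmogorov's backward equation. -/
theorem IsJumpTransitionFunction.isBackwardSol (hP : IsJumpTransitionFunction b σ h P) (j : ℤ) :
    IsBackwardSol (rateRight b σ h) (rateLeft b σ h) (fun t i => P t i j) := by
  refine ⟨fun i => hP.continuousOn i j, fun t ht i => ?_⟩
  have hsum : ∀ g : ℤ → ℝ, ∑ k ∈ {i - 1, i, i + 1}, g k = g (i - 1) + g i + g (i + 1) := fun g => by
    rw [Finset.sum_insert, Finset.sum_insert, Finset.sum_singleton, add_assoc]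
    · simp
    · simp; omega
  have q0 : jumpQ b σ h i i = -(rateRight b σ h i + rateLeft b σ h i) := by simp [jumpQ]
  have q1 : jumpQ b σ h i (i + 1) = rateRight b σ h i := by simp [jumpQ]
  have q2 : jumpQ b σ h i (i - 1) = rateLeft b σ h i := by
    have : i - 1 ≠ i + 1 := by omega
    simp [jumpQ, this]
  have d0 := hP.hasDeriv_zero i i
  have d1 := hP.hasDeriv_zero i (i + 1)
  have d2 := hP.hasDeriv_zero i (i - 1)
  rw [q0] at d0
  rw [q1] at d1
  rw [q2] at d2
  set R : ℝ → ℝ := fun s => P (s + t) i j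
    - (P s i (i - 1) * P t (i - 1) j + P s i i * P t i j + P s i (i + 1) * P t (i + 1) j) with hR
  have z1 : P 0 i (i - 1) = 0 := by rw [hP.zero, if_neg (by omega)]
  have z2 : P 0 i (i + 1) = 0 := by simp [hP.zero]
  have z3 : P 0 i i = 1 := by simp [hP.zero]
  have hR0 : R 0 = 0 := by simp [hR, z1, z2, z3]
  -- The mass outside the three sites has derivative zero at time `0`, because the row of the
  -- `Q`-matrix sums to zero. It bounds `R`, so `R` is negligible to first order.
  have hη : HasDerivWithinAt (fun s => 1 - (P s i (i - 1) + P s i i + P s i (i + 1))) 0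
      (Set.Ici 0) 0 :=
    (((d2.fun_add d0).fun_add d1).const_sub 1).congr_deriv (by ring)
  have hRder : HasDerivWithinAt R 0 (Set.Ici 0) 0 := by
    rw [hasDerivWithinAt_iff_isLittleO] at hη ⊢
    refine Asymptotics.IsBigO.trans_isLittleO (Asymptotics.IsBigO.of_bound 1 ?_) hη
    filter_upwards [self_mem_nhdsWithin] with s hs
    obtain ⟨h1, h2⟩ := hP.chapman_kolmogorov_bounds hs ht i j {i - 1, i, i + 1}
    rw [hsum] at h1 h2
    rw [hsum] at h2
    simp only [hR0, z1, z2, z3, sub_zero, smul_zero, zero_add, add_zero, sub_self, one_mul]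
    rw [Real.norm_of_nonneg h1, Real.norm_of_nonneg (h1.trans h2)]
    exact h2
  have hder : HasDerivWithinAt (fun s => P (s + t) i j)
      (birthDeathGen (rateRight b σ h) (rateLeft b σ h) (fun k => P t k j) i) (Set.Ici 0) 0 := by
    have := hRder.fun_add (((d2.mul_const (P t (i - 1) j)).fun_add
      (d0.mul_const (P t i j))).fun_add (d1.mul_const (P t (i + 1) j)))
    simp only [hR, sub_add_cancel] at this
    refine this.congr_deriv ?_
    rw [birthDeathGen]
    ring
  have hshift := HasDerivWithinAt.scomp_of_eq t hder (h := fun r => r - t) (h' := 1)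
    (s := Set.Ici t) ((hasDerivWithinAt_id t _).sub_const t)
    (fun r hr => by simpa using hr) (by simp)
  simpa [Function.comp_def] using hshift

/-! ### The upwind scheme as a birth-death forward equation -/

theorem sPlus_nonneg (j : ℤ) : 0 ≤ sPlus b σ h j := le_max_right _ _

theorem sMinus_nonneg (j : ℤ) : 0 ≤ sMinus b σ h j := neg_nonneg.2 (min_le_right _ _)

/-- A nonnegative sequence on `ℕ` that eventually vanishes is bounded. -/
theorem exists_le_of_eventually_eq_zero {g : ℕ → ℝ} (hg : ∀ n, 0 ≤ g n)
    (h0 : ∀ᶠ n in atTop, g n = 0) : ∃ A, ∀ n, g n ≤ A := by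
  obtain ⟨N, hN⟩ := eventually_atTop.1 h0
  refine ⟨∑ k ∈ Finset.range N, g k, fun n => ?_⟩
  rcases lt_or_ge n N with hn | hn
  · exact Finset.single_le_sum (fun k _ => hg k) (Finset.mem_range.2 hn)
  · rw [hN n hn]
    exact Finset.sum_nonneg fun k _ => hg k

/-- Far to the right `s` is negative, so `s⁺` vanishes and `s⁻` tends to infinity; far to the left
the roles are exchanged. The diffusive parts are bounded by `S₂ ^ 2 / (2 * h ^ 2)` and positive by
ellipticity. -/
theorem confiningRates_rateRight_rateLeft (hconf : WeakConfinement b σ)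
    (hspeed : Tendsto (fun x : ℝ => -(advSpeed b σ x * x) / |x|) (cocompact ℝ) atTop)
    (hh : 0 < h) : ConfiningRates (rateRight b σ h) (rateLeft b σ h) := by
  obtain ⟨S₂, hS₂⟩ := hconf.bounded
  obtain ⟨S₁, hS₁, hell⟩ := hconf.elliptic
  have hc : 0 < 1 / (2 * h ^ 2) := by positivity
  have hpos : ∀ j, 0 < 1 / (2 * h ^ 2) * sigmaSqHalf σ h j := fun j =>
    mul_pos hc (hS₁.trans_le (hell _))
  have hle : ∀ j, 1 / (2 * h ^ 2) * sigmaSqHalf σ h j ≤ 1 / (2 * h ^ 2) * S₂ ^ 2 := fun j => by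
    refine mul_le_mul_of_nonneg_left ?_ hc.le
    rw [sigmaSqHalf, ← sq_abs]
    exact pow_le_pow_left₀ (abs_nonneg _) (hS₂ _) 2
  have hp : ∀ j, 0 ≤ sPlus b σ h j / h := fun j => div_nonneg (sPlus_nonneg j) hh.le
  have hm : ∀ j, 0 ≤ sMinus b σ h j / h := fun j => div_nonneg (sMinus_nonneg j) hh.le
  rw [cocompact_eq_atBot_atTop, tendsto_sup] at hspeed
  have htop : Tendsto (fun j : ℤ => -advSpeed b σ (j * h)) atTop atTop := by
    have h1 : Tendsto (fun j : ℤ => (j : ℝ) * h) atTop atTop :=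
      tendsto_intCast_atTop_atTop.atTop_mul_const hh
    refine (hspeed.2.comp h1).congr' ?_
    filter_upwards [h1.eventually_gt_atTop 0] with j hj
    simp only [Function.comp_apply, abs_of_pos hj]
    rw [neg_div, mul_div_cancel_right₀ _ hj.ne']
  have hbot : Tendsto (fun j : ℤ => advSpeed b σ (j * h)) atBot atTop := by
    have h1 : Tendsto (fun j : ℤ => (j : ℝ) * h) atBot atBot :=
      (tendsto_intCast_atBot_iff.2 tendsto_id).atBot_mul_const hh
    refine (hspeed.1.comp h1).congr' ?_
    filter_upwards [h1.eventually_lt_atBot 0] with j hj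
    simp only [Function.comp_apply, abs_of_neg hj]
    rw [neg_div_neg_eq, mul_div_cancel_right₀ _ hj.ne]
  have hcast : Tendsto (fun n : ℕ => (n : ℤ)) atTop atTop := tendsto_natCast_atTop_atTop
  refine ⟨fun j => add_pos_of_nonneg_of_pos (hp j) (hpos j),
    fun j => add_pos_of_nonneg_of_pos (hm j) (hpos _), ?_, ?_, ?_⟩
  · obtain ⟨A, hA⟩ := exists_le_of_eventually_eq_zero (g := fun n : ℕ => sPlus b σ h n / h)
      (fun n => hp n) (by
        filter_upwards [(htop.comp hcast).eventually_ge_atTop 0] with n hn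
        simp only [Function.comp_apply] at hn
        rw [sPlus, max_eq_right (by linarith), zero_div])
    obtain ⟨A', hA'⟩ := exists_le_of_eventually_eq_zero
      (g := fun n : ℕ => sMinus b σ h (-(n : ℤ)) / h) (fun n => hm _) (by
        filter_upwards [(hbot.comp (tendsto_neg_atTop_atBot.comp hcast)).eventually_ge_atTop 0]
          with n hn
        simp only [Function.comp_apply] at hn
        rw [sMinus, min_eq_right hn, neg_zero, zero_div])
    refine ⟨max A A' + 1 / (2 * h ^ 2) * S₂ ^ 2, fun j hj => ?_, fun j hj => ?_⟩
    · lift j to ℕ using hj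
      exact add_le_add ((hA j).trans (le_max_left _ _)) (hle _)
    · obtain ⟨n, rfl⟩ : ∃ n : ℕ, j = -(n : ℤ) := ⟨(-j).toNat, by omega⟩
      exact add_le_add ((hA' n).trans (le_max_right _ _)) (hle _)
  · refine tendsto_atTop_mono (fun j => ?_) (htop.atTop_div_const hh)
    have : -advSpeed b σ (j * h) ≤ sMinus b σ h j := neg_le_neg (min_le_left _ _)
    have := div_le_div_of_nonneg_right this hh.le
    rw [rateLeft]
    linarith [hpos (j - 1)]
  · refine tendsto_atTop_mono (fun j => ?_) (hbot.atTop_div_const hh)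
    have : advSpeed b σ (j * h) ≤ sPlus b σ h j := le_max_left _ _
    have := div_le_div_of_nonneg_right this hh.le
    rw [rateRight]
    linarith [hpos j]

theorem upwindRHS_eq_birthDeathFwd (p : ℤ → ℝ) (j : ℤ) :
    upwindRHS b σ h p j = birthDeathFwd (rateRight b σ h) (rateLeft b σ h) p j := by
  simp only [upwindRHS, birthDeathFwd, rateRight, rateLeft, add_sub_cancel_right]
  ring

theorem isUpwindSolution_iff_isForwardSol (hh : 0 < h) {ρ : ℝ → ℤ → ℝ} :
    IsUpwindSolution b σ h ρ ↔ IsForwardSol (rateRight b σ h) (rateLeft b σ h) ρ := by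
  constructor
  · rintro ⟨h1, h2, h3, h4⟩
    refine ⟨h1, h2, fun t ht => ?_, fun t ht j => ?_⟩
    · have := h3 t ht
      rw [tsum_mul_left, tsum_mul_left] at this
      exact mul_left_cancel₀ hh.ne' this
    · rw [← upwindRHS_eq_birthDeathFwd]
      exact h4 t ht j
  · rintro ⟨h1, h2, h3, h4⟩
    refine ⟨h1, h2, fun t ht => ?_, fun t ht j => ?_⟩
    · rw [tsum_mul_left, tsum_mul_left, h3 t ht]
    · rw [upwindRHS_eq_birthDeathFwd]
      exact h4 t ht j

theorem isJumpTransitionFunction_birthDeathTransition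
    (hab : ConfiningRates (rateRight b σ h) (rateLeft b σ h)) :
    IsJumpTransitionFunction b σ h
      (birthDeathTransition (rateRight b σ h) (rateLeft b σ h)) where
  nonneg := transition_nonneg hab
  total := hasSum_transition hab
  zero := transition_zero hab
  chapman_kolmogorov := transition_chapman_kolmogorov hab
  hasDeriv_zero i j := by
    refine (semigroup_hasDerivWithinAt hab (abs_indicator_le j) 0 le_rfl i).congr_deriv ?_
    simp only [birthDeathGen, semigroup_zero hab (abs_indicator_le j), jumpQ]
    rcases eq_or_ne j i with rfl | h1
    · simp
      ring
    rcases eq_or_ne j (i + 1) with rfl | h2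
    · have : i - 1 ≠ i + 1 := by omega
      simp [this]
    rcases eq_or_ne j (i - 1) with rfl | h3
    · have : i + 1 ≠ i - 1 := by omega
      have h4 : i - 1 ≠ i + 1 := by omega
      simp [this, h4, h1.symm]
    · simp [h1, h2, h3, h1.symm, h2.symm, h3.symm]

theorem IsJumpTransitionFunction.eq_birthDeathTransition
    (hab : ConfiningRates (rateRight b σ h) (rateLeft b σ h))
    (hP : IsJumpTransitionFunction b σ h P) (t : ℝ) (ht : 0 ≤ t) :
    P t = birthDeathTransition (rateRight b σ h) (rateLeft b σ h) t := by
  funext i j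
  refine (hP.isBackwardSol j).eq_semigroup hab (fun i => hP.zero i j) (B := 1)
    (fun s hs k => ?_) t ht i
  rw [abs_of_nonneg (hP.nonneg s hs k j)]
  exact hP.le_one s hs k j

theorem IsStationaryDistribution.detailed_balance
    (hab : ConfiningRates (rateRight b σ h) (rateLeft b σ h)) {π : ℤ → ℝ}
    (hπ : IsStationaryDistribution b σ h π) (j : ℤ) :
    rateRight b σ h j * π j = rateLeft b σ h (j + 1) * π (j + 1) :=
  detailed_balance_of_fwd_eq_zero hab hπ.nonneg hπ.total.summable hπ.stationary j

end

/-! ### Convergence in `ℓ¹` and the main theorem -/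

section
variable {a b : ℤ → ℝ}

theorem tendsto_law (hab : ConfiningRates a b) {π : ℤ → ℝ} (h0 : ∀ j, 0 < π j)
    (hs : HasSum π 1) (h : ∀ j, a j * π j = b (j + 1) * π (j + 1)) {r : ℤ → ℝ}
    (hr : ∀ i, 0 ≤ r i) (hr1 : HasSum r 1) (j : ℤ) :
    Tendsto (fun t => birthDeathLaw a b r t j) atTop (𝓝 (π j)) := by
  have : Tendsto (fun t => birthDeathLaw a b r t j) atTop (𝓝 (∑' i, r i * π j)) := by
    refine tendsto_tsum_of_dominated_convergence hr1.summable
      (fun i => (tendsto_transition hab h0 hs h i j).const_mul (r i)) ?_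
    filter_upwards [eventually_ge_atTop 0] with t ht i
    rw [Real.norm_of_nonneg (mul_nonneg (hr i) (transition_nonneg hab t ht i j))]
    exact mul_le_of_le_one_right (hr i) (transition_le_one hab t ht i j)
  rwa [tsum_mul_right, hr1.tsum_eq, one_mul] at this

/-- Convergence to equilibrium in `ℓ¹` for initial laws that are dominated by the stationary one. -/
theorem tendsto_tsum_abs_law_sub (hab : ConfiningRates a b) {π : ℤ → ℝ} (h0 : ∀ j, 0 < π j)
    (hs : HasSum π 1) (h : ∀ j, a j * π j = b (j + 1) * π (j + 1)) {r : ℤ → ℝ}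
    (hr : ∀ i, 0 ≤ r i) (hr1 : HasSum r 1) {C : ℝ} (hC : ∀ j, r j ≤ C * π j) (M m : ℝ) :
    Tendsto (fun t => ∑' j, |M * birthDeathLaw a b r t j - m * π j|) atTop (𝓝 |M - m|) := by
  have hπ0 : ∀ j, 0 ≤ π j := fun j => (h0 j).le
  -- Nonnegative transition probabilities preserve the order of initial data, and `C π` is
  -- invariant, so the initial domination persists.
  have hdom : ∀ t, 0 ≤ t → ∀ j, birthDeathLaw a b r t j ≤ C * π j := by
    intro t ht j
    rw [← law_eq_of_detailed_balance hab hπ0 hs.summable h t ht j, birthDeathLaw, birthDeathLaw,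
      ← tsum_mul_left]
    refine (summable_mul_transition hab hr hr1.summable t ht j).tsum_le_tsum (fun i => ?_)
      ((summable_mul_transition hab hπ0 hs.summable t ht j).mul_left C)
    rw [← mul_assoc]
    exact mul_le_mul_of_nonneg_right (hC i) (transition_nonneg hab t ht i j)
  have hlim : Tendsto (fun t => ∑' j, |M * birthDeathLaw a b r t j - m * π j|) atTop
      (𝓝 (∑' j, |M * π j - m * π j|)) := by
    refine tendsto_tsum_of_dominated_convergence (hs.summable.mul_left (|M| * C + |m|))
      (fun j => (((tendsto_law hab h0 hs h hr hr1 j).const_mul M).sub_const _).abs) ?_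
    filter_upwards [eventually_ge_atTop 0] with t ht j
    have hl := (law_isForwardSol hab hr hr1.summable).nonneg t ht j
    rw [Real.norm_eq_abs, abs_abs]
    refine (abs_sub _ _).trans ?_
    rw [abs_mul, abs_mul, abs_of_nonneg hl, abs_of_pos (h0 j)]
    have := mul_le_mul_of_nonneg_left (hdom t ht j) (abs_nonneg M)
    linarith
  have e : ∀ j, |M * π j - m * π j| = |M - m| * π j := fun j => by
    rw [← sub_mul, abs_mul, abs_of_pos (h0 j)]
  simpa only [e, tsum_mul_left, hs.tsum_eq, mul_one] using hlim

end

theorem proposition4p2 (b σ : ℝ → ℝ) (hconf : WeakConfinement b σ)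
    (hspeed : Tendsto (fun x : ℝ => -(advSpeed b σ x * x) / |x|) (cocompact ℝ) atTop)
    (h : ℝ) (hh : 0 < h) :
    -- the stationary distribution, the jump process and the upwind solution are well defined
    (∃! π : ℤ → ℝ, IsStationaryDistribution b σ h π) ∧
    (∃ P : ℝ → ℤ → ℤ → ℝ, IsJumpTransitionFunction b σ h P ∧
      ∀ P', IsJumpTransitionFunction b σ h P' → ∀ t, 0 ≤ t → P' t = P t) ∧
    (∀ ρ₀ : ℤ → ℝ, (∀ j, 0 ≤ ρ₀ j) → Summable ρ₀ →
      ∃ ρ : ℝ → ℤ → ℝ, IsUpwindSolution b σ h ρ ∧ ρ 0 = ρ₀ ∧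
        ∀ ρ', IsUpwindSolution b σ h ρ' → ρ' 0 = ρ₀ → ∀ t, 0 ≤ t → ρ' t = ρ t) ∧
    ∀ (π : ℤ → ℝ) (P : ℝ → ℤ → ℤ → ℝ),
      IsStationaryDistribution b σ h π → IsJumpTransitionFunction b σ h P →
      -- pointwise convergence of the transition probabilities
      (∀ i j, Tendsto (fun t => P t i j) atTop (𝓝 (π j))) ∧
      ∀ ρ : ℝ → ℤ → ℝ, IsUpwindSolution b σ h ρ → 0 < gridL1Norm h (ρ 0) →
        -- the normalized solution is the law of the jump process
        (∀ t, 0 ≤ t → ∀ j,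
          HasSum (fun i => normalizedSol h ρ 0 i * P t i j) (normalizedSol h ρ t j)) ∧
        ∀ C : ℝ, (∀ j, normalizedSol h ρ 0 j ≤ C * π j) →
          Tendsto (fun t => ∑' j, |normalizedSol h ρ t j - π j|) atTop (𝓝 0) ∧
          Tendsto (fun t => gridL1Norm h
            (fun j => ρ t j - 1 / h * π j * gridL1Norm h (ρ 0))) atTop (𝓝 0) ∧
          -- scaling by the mass of a continuous initial datum instead of the discrete one
          ∀ f : ℝ → ℝ, Integrable f volume →
            Tendsto (fun t => gridL1Norm h
              (fun j => ρ t j - 1 / h * π j * ∫ x, |f x|)) atTop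
              (𝓝 (abs (gridL1Norm h (ρ 0) - ∫ x, |f x|))) := by
  have hab := confiningRates_rateRight_rateLeft hconf hspeed hh
  set α := rateRight b σ h with hα
  set β := rateLeft b σ h with hβ
  obtain ⟨π₀, hπpos, hπsum, hπbal⟩ := exists_detailed_balance hab
  have hunique : ∀ π, IsStationaryDistribution b σ h π → π = π₀ := fun π hπ =>
    eq_of_detailed_balance hab (hπ.detailed_balance hab) hπbal hπ.total hπsum
  refine ⟨⟨π₀, ⟨fun j => (hπpos j).le, hπsum, fwd_eq_zero_of_detailed_balance hπbal⟩, hunique⟩,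
    ⟨birthDeathTransition α β, isJumpTransitionFunction_birthDeathTransition hab,
      fun P' hP' t ht => hP'.eq_birthDeathTransition hab t ht⟩, fun ρ₀ h0 hs => ?_,
    fun π P hπ hP => ?_⟩
  · refine ⟨birthDeathLaw α β ρ₀,
      (isUpwindSolution_iff_isForwardSol hh).2 (law_isForwardSol hab h0 hs), law_zero hab ρ₀,
      fun ρ' hρ' hρ0 t ht => ?_⟩
    funext j
    rw [((isUpwindSolution_iff_isForwardSol hh).1 hρ').eq_law hab t ht j, hρ0]
  · obtain rfl := hunique π hπ
    have hPeq := fun t ht => hP.eq_birthDeathTransition hab t ht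
    refine ⟨fun i j => (tendsto_transition hab hπpos hπsum hπbal i j).congr' ?_,
      fun ρ hρ hM => ?_⟩
    · filter_upwards [eventually_ge_atTop 0] with t ht
      rw [hPeq t ht]
    have hρf := (isUpwindSolution_iff_isForwardSol hh).1 hρ
    have hρ0 := hρf.nonneg 0 le_rfl
    have hρs := hρf.summable 0 le_rfl
    set M := gridL1Norm h (ρ 0) with hMdef
    set r : ℤ → ℝ := normalizedSol h ρ 0 with hr
    have hMsum : M = h * ∑' j, ρ 0 j := by
      rw [hMdef, gridL1Norm, ← tsum_mul_left]
      exact tsum_congr fun j => by rw [abs_of_nonneg (hρ0 j)]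
    have hr_eq : ∀ t j, normalizedSol h ρ t j = h / M * ρ t j := fun t j => by
      rw [normalizedSol, ← hMdef]; ring
    have hr0 : ∀ i, 0 ≤ r i := fun i => by
      rw [hr, hr_eq]
      exact mul_nonneg (by positivity) (hρ0 i)
    have hr1 : HasSum r 1 := by
      have h1 := hρs.hasSum.mul_left (h / M)
      rw [div_mul_eq_mul_div, ← hMsum, div_self hM.ne'] at h1
      simpa only [← hr_eq] using h1
    have hlaw : ∀ t, 0 ≤ t → ∀ j, normalizedSol h ρ t j = birthDeathLaw α β r t j := by
      intro t ht j
      rw [hr_eq, hρf.eq_law hab t ht j, birthDeathLaw, birthDeathLaw, ← tsum_mul_left]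
      exact tsum_congr fun i => by rw [hr, hr_eq, mul_assoc]
    refine ⟨fun t ht j => ?_, fun C hC => ?_⟩
    · rw [hlaw t ht j, hPeq t ht]
      exact (summable_mul_transition hab hr0 hr1.summable t ht j).hasSum
    have hgrid : ∀ m t, 0 ≤ t → ∑' j, |M * birthDeathLaw α β r t j - m * π j|
        = gridL1Norm h (fun j => ρ t j - 1 / h * π j * m) := by
      intro m t ht
      refine tsum_congr fun j => ?_
      rw [← hlaw t ht j, hr_eq, ← abs_of_pos hh, ← abs_mul, abs_of_pos hh]
      congr 1
      field_simp
    have hlim := tendsto_tsum_abs_law_sub hab hπpos hπsum hπbal hr0 hr1 hC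
    -- The choice `m = M` gives convergence to equilibrium, and `m = ∫ |f|` leaves exactly the mass
    -- discrepancy.
    have hlim_grid : ∀ m, Tendsto (fun t => gridL1Norm h (fun j => ρ t j - 1 / h * π j * m)) atTop
        (𝓝 |M - m|) := fun m => by
      refine (hlim M m).congr' ?_
      filter_upwards [eventually_ge_atTop 0] with t ht
      exact hgrid m t ht
    refine ⟨?_, ?_, fun f _ => hlim_grid _⟩
    · have h1 := hlim 1 1
      rw [sub_self, abs_zero] at h1
      refine h1.congr' ?_
      filter_upwards [eventually_ge_atTop 0] with t ht
      simp only [one_mul, hlaw t ht]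
    · simpa using hlim_grid M
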